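/- Let $(E,[\![\cdot,\cdot]\!],\rho)$ be a Lie algebroid over a smooth (finite-dimensional, Hausdorff, boundaryless) manifold $Q$: $\tau:E\to Q$ is a smooth real vector bundle of finite rank, $[\![\cdot,\cdot]\!]$ is a Lie bracket on the space of smooth sections of $E$, and the anchor $\rho:E\to TQ$ is a smooth vector bundle map over $\mathrm{Id}_Q$ such that $[\![\sigma,f\sigma']\!]=f[\![\sigma,\sigma']\!]+(\rho(\sigma)f)\,\sigma'$ for all smooth sections $\sigma,\sigma'$ and all $f\in C^\infty(Q)$. For a Lie algebroid $A$ with anchor $\rho_A$, the differential of a $k$-form $\mu\in\Gamma(\wedge^kA^*)$, $k\ge 0$, is the $(k+1)$-form $$(d^A\mu)(\sigma_0,\dots,\sigma_k)=\sum_{i}(-1)^i\rho_A(\sigma_i)\bigl(\mu(\sigma_0,\dots,\widehat{\sigma_i},\dots,\sigma_k)\bigr)+\sum_{i<j}(-1)^{i+j}\mu([\![\sigma_i,\sigma_j]\!],\sigma_0,\dots,\widehat{\sigma_i},\dots,\widehat{\sigma_j},\dots,\sigma_k);$$ in particular $(d^Af)(a)=\rho_A(a)f$ for a smooth function $f$.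 A smooth vector bundle map $\Phi:A\to B$ over $f:M\to N$ between Lie algebroids $A\to M$ and $B\to N$ is a Lie algebroid morphism if $d^A((\Phi,f)^*\mu)=(\Phi,f)^*(d^B\mu)$ for every smooth $k$-form $\mu$ of $B$ and every $k\ge 0$, where $((\Phi,f)^*\mu)_x(a_1,\dots,a_k)=\mu_{f(x)}(\Phi a_1,\dots,\Phi a_k)$. Let $\pi:E^*\times\mathbb R\to Q$, $(b,s)\mapsto q$ for $b\in E_q^*$, be the projection. The prolongation $\mathcal T^E(E^*\times\mathbb R)$ is the Lie algebroid over $E^*\times\mathbb R$ whose fibre at $p$ is $$\{(a,v)\in E_{\pi(p)}\times T_p(E^*\times\mathbb R)\;:\;\rho(a)=T_p\pi(v)\},$$ whose anchor is $(a,v)\mapsto v$, and whose bracket is given as follows. If $(e_\alpha)$ is a local frame of $E$ and two sections are written as $Z_1=(\sum_\alpha f_\alpha\,e_\alpha\circ\pi,\,X_1)$ and $Z_2=(\sum_\beta g_\beta\,e_\beta\circ\pi,\,X_2)$, with smooth functions $f_\alpha,g_\beta$ and smooth vector fields $X_1,X_2$ on $E^*\times\mathbb R$, then $$[\![Z_1,Z_2]\!]=\Bigl(\sum_{\alpha,\beta}f_\alpha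 g_\beta\,[\![e_\alpha,e_\beta]\!]\circ\pi+\sum_\beta X_1(g_\beta)\,e_\beta\circ\pi-\sum_\alpha X_2(f_\alpha)\,e_\alpha\circ\pi,\;[X_1,X_2]\Bigr).$$ The contact section of $\mathcal T^E(E^*\times\mathbb R)$ is the $1$-form $\eta=\widetilde{\mathcal V}^s-\Theta$, where $\widetilde{\mathcal V}^s_{(b,s)}(a,v)=ds(v)$ and $\Theta_{(b,s)}(a,v)=b(a)$ (the Liouville section). Let $\gamma=(\gamma_0,\gamma_s):Q\to E^*\times\mathbb R$ be any smooth section of $\pi$, with components $\gamma_0\in\Gamma(E^*)$ and $\gamma_s\in C^\infty(Q)$, and let $(\mathrm{Id}_E,T\gamma\circ\rho):E\to\mathcal T^E(E^*\times\mathbb R)$ be the bundle map over $\gamma$ that sends $a\in E_q$ to $(a,\,T_q\gamma(\rho(a)))$. Then: 1. the pair $\bigl((\mathrm{Id}_E,T\gamma\circ\rho),\gamma\bigr)$ is a Lie algebroid morphism from $E$ to $\mathcal T^E(E^*\times\mathbb R)$; 2. $\bigl((\mathrm{Id}_E,T\gamma\circ\rho),\gamma\bigr)^*\eta=d^E\gamma_s-\gamma_0$.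 -/

import Mathlib

open Bundle Set Filter Topology Module VectorField
open scoped Manifold ContDiff

noncomputable section

/-! ### Preliminaries on vector fields -/

section Calculus

variable {EM : Type*} [NormedAddCommGroup EM] [NormedSpace ℝ EM]
  {HM : Type*} [TopologicalSpace HM] {I : ModelWithCorners ℝ EM HM}
  {M : Type*} [TopologicalSpace M] [ChartedSpace HM M] [IsManifold I ∞ M]

theorem contMDiff_mvfderiv_apply (h : M → ℝ) (hh : ContMDiff I 𝓘(ℝ, ℝ) ∞ h)
    (V : ∀ z : M, TangentSpace I z)
    (hV : ContMDiff I I.tangent ∞ (fun y => (⟨y, V y⟩ : TangentBundle I M))) :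
    ContMDiff I 𝓘(ℝ, ℝ) ∞ (fun y => mvfderiv I h y (V y)) :=
  (contMDiff_snd_tangentBundle_modelSpace ℝ 𝓘(ℝ, ℝ)).comp
    ((hh.contMDiff_tangentMap (m := ∞) le_rfl).comp hV)

theorem mvfderiv_congr {g g' : M → ℝ} {x : M} (hg : g =ᶠ[𝓝 x] g') :
    mvfderiv I g x = mvfderiv I g' x := by
  ext v
  simp only [mvfderiv]
  rw [hg.mfderiv_eq]
  rfl

theorem mvfderiv_finset_sum {ι : Type*} (s : Finset ι) (g : ι → M → ℝ) (x : M)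
    (hg : ∀ i, MDifferentiableAt I 𝓘(ℝ, ℝ) (g i) x) :
    mvfderiv I (fun y => ∑ i ∈ s, g i y) x = ∑ i ∈ s, mvfderiv I (g i) x := by
  classical
  induction s using Finset.induction_on with
  | empty => simpa using mvfderiv_const (I := I) (0 : ℝ) (x := x)
  | insert i s hi ih =>
    have hs : MDifferentiableAt I 𝓘(ℝ, ℝ) (fun y => ∑ i ∈ s, g i y) x := by
      clear ih hi
      induction s using Finset.induction_on with
      | empty => simpa using mdifferentiableAt_const
      | insert j s hj ih =>
        simp only [Finset.sum_insert hj]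
        exact (hg j).add ih
    simp only [Finset.sum_insert hi]
    rw [← ih]
    exact mvfderiv_add (hg i) hs

variable [I.Boundaryless]

/-- A vector field read in the chart at `x`, applied to a function read in that chart. -/
theorem chart_deriv_apply (x : M) (z : EM) (hz : z ∈ (extChartAt I x).target)
    (g : M → ℝ) (hg : MDifferentiableAt I 𝓘(ℝ, ℝ) g ((extChartAt I x).symm z))
    (V : ∀ z : M, TangentSpace I z) :
    fderiv ℝ (g ∘ (extChartAt I x).symm) z
      (mpullbackWithin 𝓘(ℝ, EM) I (extChartAt I x).symm V (range I) z) =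
    mvfderiv I g ((extChartAt I x).symm z) (V ((extChartAt I x).symm z)) := by
  obtain ⟨L, hL⟩ := isInvertible_mfderivWithin_extChartAt_symm (I := I) hz
  have h1 : fderiv ℝ (g ∘ (extChartAt I x).symm) z =
      (mvfderiv I g ((extChartAt I x).symm z)) ∘L
        (mfderivWithin 𝓘(ℝ, EM) I (extChartAt I x).symm (range I) z) := by
    have := mdifferentiableWithinAt_extChartAt_symm (I := I) hz
    rw [I.range_eq_univ, mdifferentiableWithinAt_univ] at this
    rw [I.range_eq_univ, mfderivWithin_univ, ← mvfderiv_comp z hg this]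
    simp only [mvfderiv, mfderiv_eq_fderiv]
    rfl
  rw [h1, mpullbackWithin_apply, ← hL, ContinuousLinearMap.inverse_equiv]
  change mvfderiv I g _ (L (L.symm _)) = _
  rw [L.apply_symm_apply]

theorem mvfderiv_mlieBracket [CompleteSpace EM] (x : M) (h : M → ℝ) (hh : ContMDiff I 𝓘(ℝ, ℝ) ∞ h)
    (V W : ∀ z : M, TangentSpace I z)
    (hV : ContMDiff I I.tangent ∞ (fun y => (⟨y, V y⟩ : TangentBundle I M)))
    (hW : ContMDiff I I.tangent ∞ (fun y => (⟨y, W y⟩ : TangentBundle I M)))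
    (hhV : MDifferentiableAt I 𝓘(ℝ, ℝ) (fun y => mvfderiv I h y (V y)) x)
    (hhW : MDifferentiableAt I 𝓘(ℝ, ℝ) (fun y => mvfderiv I h y (W y)) x) :
    mvfderiv I h x (mlieBracket I V W x) =
      mvfderiv I (fun y => mvfderiv I h y (W y)) x (V x) -
      mvfderiv I (fun y => mvfderiv I h y (V y)) x (W x) := by
  set φ := extChartAt I x with hφ
  have hx : φ x ∈ φ.target := mem_extChartAt_target x
  have hdh : ∀ y, MDifferentiableAt I 𝓘(ℝ, ℝ) h y := fun y => (hh y).mdifferentiableAt (by simp)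
  have hxs : φ.symm (φ x) = x := extChartAt_to_inv x
  have key : ∀ U : (∀ z : M, TangentSpace I z),
      (fun z => fderiv ℝ (h ∘ φ.symm) z (mpullbackWithin 𝓘(ℝ, EM) I φ.symm U (range I) z))
        =ᶠ[𝓝 (φ x)] (fun y => mvfderiv I h y (U y)) ∘ φ.symm := by
    intro U
    filter_upwards [extChartAt_target_mem_nhds (I := I) x] with z hz
    exact chart_deriv_apply x z hz h (hdh _) U
  have hdV : ∀ U : (∀ z : M, TangentSpace I z),
      ContMDiff I I.tangent ∞ (fun y => (⟨y, U y⟩ : TangentBundle I M)) →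
      DifferentiableAt ℝ (mpullbackWithin 𝓘(ℝ, EM) I φ.symm U (range I)) (φ x) := by
    intro U hU
    have := MDifferentiableWithinAt.differentiableWithinAt_mpullbackWithin_vectorField
      (s := univ) (V := U) (x := x)
      (((hU x).mdifferentiableAt (by simp)).mdifferentiableWithinAt)
    rw [preimage_univ, univ_inter] at this
    rw [← hφ] at this
    have h2 : range I = univ := I.range_eq_univ
    exact this.differentiableAt (by rw [h2]; exact univ_mem)
  have hh' : ContDiffAt ℝ ∞ (h ∘ φ.symm) (φ x) := by
    have h1 := contMDiffWithinAt_extChartAt_symm_range (I := I) (n := ∞) x hx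
    rw [I.range_eq_univ, contMDiffWithinAt_univ] at h1
    exact (((hh _).comp (φ x) h1)).contDiffAt
  have e := fderiv_apply_lieBracket (f := h ∘ φ.symm) (n := ∞) hh' (by simpa using (WithTop.coe_le_coe.2 le_top : ((2 : ℕ∞) : ℕ∞ω) ≤ ((⊤ : ℕ∞) : ℕ∞ω))) (hdV W hW) (hdV V hV)
  rw [(key W).fderiv_eq, (key V).fderiv_eq] at e
  rw [chart_deriv_apply x _ hx _ (by rw [hxs]; exact hhW) V,
    chart_deriv_apply x _ hx _ (by rw [hxs]; exact hhV) W] at e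
  have e2 : ∀ U₁ U₂ : (∀ z : M, TangentSpace I z),
      mvfderiv I (fun y => mvfderiv I h y (U₂ y)) (φ.symm (φ x)) (U₁ (φ.symm (φ x))) =
        mvfderiv I (fun y => mvfderiv I h y (U₂ y)) x (U₁ x) := by
    intro U₁ U₂; rw [hxs]
  rw [e2, e2] at e
  rw [← e]
  have hhφ : h =ᶠ[𝓝 x] (h ∘ φ.symm) ∘ φ := by
    filter_upwards [extChartAt_source_mem_nhds (I := I) x] with y hy
    simp only [Function.comp_apply, hφ, (extChartAt I x).left_inv hy]
  have hmφ : MDifferentiableAt I 𝓘(ℝ, EM) φ x :=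
    mdifferentiableAt_extChartAt (mem_chart_source HM x)
  have h3 : mvfderiv I h x = (mvfderiv 𝓘(ℝ, EM) (h ∘ φ.symm) (φ x)) ∘L (mfderiv I 𝓘(ℝ, EM) φ x) := by
    rw [← mvfderiv_comp x (hh'.differentiableAt (by simp)).mdifferentiableAt hmφ]
    exact mvfderiv_congr hhφ
  obtain ⟨L, hL⟩ := isInvertible_mfderiv_extChartAt (I := I) (mem_extChartAt_source (I := I) x)
  rw [← mlieBracketWithin_univ, mlieBracketWithin_apply, h3, ← hφ]
  rw [← hφ] at hL
  have hb : ∀ A B : EM → EM,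
      lieBracketWithin ℝ A B (range I) (φ x) = lieBracket ℝ A B (φ x) := by
    intro A B; rw [I.range_eq_univ, lieBracketWithin_univ]
  rw [← hL, ContinuousLinearMap.inverse_equiv, preimage_univ, univ_inter]
  refine (congrArg (mvfderiv 𝓘(ℝ, EM) (h ∘ φ.symm) (φ x)) (L.apply_symm_apply _)).trans ?_
  refine (congrArg (mvfderiv 𝓘(ℝ, EM) (h ∘ φ.symm) (φ x)) (hb _ _)).trans ?_
  simp only [mvfderiv, mfderiv_eq_fderiv]
  rfl

/-- Smooth functions separate tangent vectors. -/
theorem tangent_ext [FiniteDimensional ℝ EM] [T2Space M] {x : M} (v w : TangentSpace I x)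
    (hvw : ∀ h : M → ℝ, ContMDiff I 𝓘(ℝ, ℝ) ∞ h → mvfderiv I h x v = mvfderiv I h x w) :
    v = w := by
  obtain ⟨L, hL⟩ := isInvertible_mfderiv_extChartAt (I := I) (mem_extChartAt_source (I := I) x)
  apply L.injective
  let b := finBasis ℝ EM
  apply b.ext_elem
  intro i
  let l : EM →L[ℝ] ℝ := LinearMap.toContinuousLinearMap (b.coord i)
  obtain ⟨ψ⟩ : Nonempty (SmoothBumpFunction I x) := inferInstance
  let h : M → ℝ := fun y => ψ y • l (extChartAt I x y)
  have hh : ContMDiff I 𝓘(ℝ, ℝ) ∞ h := by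
    apply ψ.contMDiff_smul
    exact l.contMDiff.comp_contMDiffOn (contMDiffOn_extChartAt)
  have hmφ : MDifferentiableAt I 𝓘(ℝ, EM) (extChartAt I x) x :=
    mdifferentiableAt_extChartAt (mem_chart_source HM x)
  have hev : h =ᶠ[𝓝 x] (l : EM → ℝ) ∘ (extChartAt I x) := by
    filter_upwards [ψ.eventuallyEq_one] with y hy
    simp [h, hy]
  have e : ∀ u : TangentSpace I x, mvfderiv I h x u = l (L u) := by
    intro u
    rw [mvfderiv_congr hev, mvfderiv_comp_apply x l.differentiableAt.mdifferentiableAt hmφ, ← hL]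
    simp only [mvfderiv, mfderiv_eq_fderiv, ContinuousLinearMap.fderiv]
    rfl
  have := hvw h hh
  rw [e, e] at this
  exact this

end Calculus

/-! ### Exterior calculus and morphisms -/

section General

variable {EM : Type*} [NormedAddCommGroup EM] [NormedSpace ℝ EM]
  {HM : Type*} [TopologicalSpace HM] {I : ModelWithCorners ℝ EM HM}
  {M : Type*} [TopologicalSpace M] [ChartedSpace HM M]
  {EN : Type*} [NormedAddCommGroup EN] [NormedSpace ℝ EN]
  {HN : Type*} [TopologicalSpace HN] {J : ModelWithCorners ℝ EN HN}
  {N : Type*} [TopologicalSpace N] [ChartedSpace HN N]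
  {A : M → Type*} [∀ x, AddCommGroup (A x)] [∀ x, Module ℝ (A x)]
  {B : N → Type*} [∀ y, AddCommGroup (B y)] [∀ y, Module ℝ (B y)]

variable (I A) in
/-- What the exterior calculus of a Lie algebroid over `M` with fibres `A x` refers to: the
smooth sections, the anchor and the bracket of sections. It is only used for the two Lie
algebroids `LieAlgebroid.data` and `LieAlgebroid.prolongationData` below. -/
structure BracketData where
  /-- The smooth sections. -/
  Sec : Type*
  /-- The value of a section at a point. -/
  eval : Sec → ∀ x, A x
  /-- The anchor map. -/
  anchor : ∀ x, A x →ₗ[ℝ] TangentSpace I x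
  /-- The bracket of sections. -/
  bracket : Sec → Sec → Sec

namespace BracketData

/-- A field `μ` of alternating `k`-linear forms on the fibres is a smooth `k`-form, i.e. a smooth
section of `⋀ᵏ A*`, if its value on any `k` smooth sections is a smooth function. -/
def IsSmoothForm (D : BracketData I A) {k : ℕ} (μ : ∀ x, A x [⋀^Fin k]→ₗ[ℝ] ℝ) : Prop :=
  ∀ Z : Fin k → D.Sec, ContMDiff I 𝓘(ℝ, ℝ) ∞ (fun x => μ x (fun i => D.eval (Z i) x))

/-- The part `∑_{i < j} (-1)^{i+j} μ([Zᵢ, Zⱼ], Z₀, …, Ẑᵢ, …, Ẑⱼ, …, Z_k)` of the exterior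
differential of a `k`-form `μ`. -/
def bracketTerm (D : BracketData I A) :
    {k : ℕ} → (∀ x, A x [⋀^Fin k]→ₗ[ℝ] ℝ) → (Fin (k + 1) → D.Sec) → M → ℝ
  | 0, _, _, _ => 0
  | k + 1, μ, Z, x =>
    ∑ j : Fin (k + 2), ∑ i : Fin (k + 1),
      if i.castSucc < j then
        (-1 : ℝ) ^ ((i : ℕ) + (j : ℕ)) *
          μ x (Fin.cons (D.eval (D.bracket (Z i.castSucc) (Z j)) x)
            (fun l : Fin k => D.eval (Z (j.succAbove (i.succAbove l))) x))
      else 0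

/-- The exterior differential of a `k`-form `μ`, evaluated on `k + 1` sections:
`(dμ)(Z₀, …, Z_k) = ∑ᵢ (-1)^i ρ(Zᵢ) μ(Z₀, …, Ẑᵢ, …, Z_k)
  + ∑_{i < j} (-1)^{i+j} μ([Zᵢ, Zⱼ], Z₀, …, Ẑᵢ, …, Ẑⱼ, …, Z_k)`. -/
def extDeriv (D : BracketData I A) {k : ℕ} (μ : ∀ x, A x [⋀^Fin k]→ₗ[ℝ] ℝ)
    (Z : Fin (k + 1) → D.Sec) (x : M) : ℝ :=
  (∑ i : Fin (k + 1), (-1 : ℝ) ^ (i : ℕ) *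
    mvfderiv I (fun y => μ y (fun l : Fin k => D.eval (Z (i.succAbove l)) y)) x
      (D.anchor x (D.eval (Z i) x))) +
  D.bracketTerm μ Z x

end BracketData

/-- The pullback `(Φ, f)*μ`, with `((Φ, f)*μ)_x(a₁, …, a_k) = μ_{f(x)}(Φ a₁, …, Φ a_k)`. -/
def pullbackForm {k : ℕ} (f : M → N) (Φ : ∀ x, A x →ₗ[ℝ] B (f x))
    (μ : ∀ y, B y [⋀^Fin k]→ₗ[ℝ] ℝ) : ∀ x, A x [⋀^Fin k]→ₗ[ℝ] ℝ :=
  fun x => (μ (f x)).compLinearMap (Φ x)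

/-- A fibrewise linear map `Φ` over `f` is a morphism of Lie algebroids if it is smooth and
`d((Φ, f)*μ) = (Φ, f)*(dμ)` for all smooth `k`-forms `μ` and all `k`. Smoothness of the bundle map
is expressed by the smoothness of the pullbacks of smooth forms. The equality of `(k + 1)`-forms
is tested at each point `x` on the values of sections `σᵢ`; there the value of `dμ` at `f x` on
the vectors `Φ(σᵢ(x))` is computed with any sections `Zᵢ` that take these values at `f x`. -/
structure IsLieAlgebroidMorphism (D : BracketData I A) (D' : BracketData J B) (f : M → N)
    (Φ : ∀ x, A x →ₗ[ℝ] B (f x)) : Prop where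
  contMDiff_base : ContMDiff I J ∞ f
  smooth_pullback : ∀ {k : ℕ} (μ : ∀ y, B y [⋀^Fin k]→ₗ[ℝ] ℝ), D'.IsSmoothForm μ →
    D.IsSmoothForm (pullbackForm f Φ μ)
  extDeriv_pullback : ∀ {k : ℕ} (μ : ∀ y, B y [⋀^Fin k]→ₗ[ℝ] ℝ), D'.IsSmoothForm μ →
    ∀ (x : M) (σ : Fin (k + 1) → D.Sec) (Z : Fin (k + 1) → D'.Sec),
      (∀ i, D'.eval (Z i) (f x) = Φ x (D.eval (σ i) x)) →
        D.extDeriv (pullbackForm f Φ μ) σ x = D'.extDeriv μ Z (f x)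

end General

/-! ### Lie algebroids -/

section Algebroid

variable {EQ : Type*} [NormedAddCommGroup EQ] [NormedSpace ℝ EQ]
  {HQ : Type*} [TopologicalSpace HQ] (I : ModelWithCorners ℝ EQ HQ)
  {Q : Type*} [TopologicalSpace Q] [ChartedSpace HQ Q]
  (F : Type*) [NormedAddCommGroup F] [NormedSpace ℝ F]
  (E : Q → Type*) [∀ q, AddCommGroup (E q)] [∀ q, Module ℝ (E q)]
  [TopologicalSpace (TotalSpace F E)] [∀ q, TopologicalSpace (E q)]
  [FiberBundle F E] [VectorBundle ℝ F E]

variable {I F E} in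
/-- The product of a smooth function and a smooth section. -/
def smulSection (f : C^∞⟮I, Q; ℝ⟯) (σ : Cₛ^∞⟮I; F, E⟯) : Cₛ^∞⟮I; F, E⟯ :=
  ⟨fun q => f q • σ q, f.contMDiff.smul_section σ.contMDiff⟩

/-- A Lie algebroid structure on the smooth vector bundle `E → Q`: a Lie bracket on the smooth
sections and a smooth vector bundle map `ρ : E → TQ` with
`[σ, f τ] = f [σ, τ] + (ρ(σ) f) τ`. -/
structure LieAlgebroid [IsManifold I ∞ Q] where
  bracket : Cₛ^∞⟮I; F, E⟯ → Cₛ^∞⟮I; F, E⟯ → Cₛ^∞⟮I; F, E⟯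
  bracket_add_left : ∀ σ₁ σ₂ τ, bracket (σ₁ + σ₂) τ = bracket σ₁ τ + bracket σ₂ τ
  bracket_smul_left : ∀ (c : ℝ) (σ τ), bracket (c • σ) τ = c • bracket σ τ
  bracket_skew : ∀ σ τ, bracket σ τ = -bracket τ σ
  jacobi : ∀ σ τ υ,
    bracket σ (bracket τ υ) + bracket τ (bracket υ σ) + bracket υ (bracket σ τ) = 0
  anchor : ∀ q, E q →ₗ[ℝ] TangentSpace I q
  contMDiff_anchor : ContMDiff (I.prod 𝓘(ℝ, F)) I.tangent ∞
    (fun a : TotalSpace F E => (⟨a.proj, anchor a.proj a.2⟩ : TangentBundle I Q))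
  leibniz : ∀ (σ τ : Cₛ^∞⟮I; F, E⟯) (f : C^∞⟮I, Q; ℝ⟯) (q : Q),
    bracket σ (smulSection f τ) q =
      f q • bracket σ τ q + mvfderiv I f q (anchor q (σ q)) • τ q

section Frame

variable [FiniteDimensional ℝ EQ] [T2Space Q] [IsManifold I ∞ Q]
  [FiniteDimensional ℝ F] [ContMDiffVectorBundle ∞ F E I]

theorem exists_bump (q₀ : Q) :
    ∃ ψ : SmoothBumpFunction I q₀, tsupport ψ ⊆ (trivializationAt F E q₀).baseSet := by
  obtain ⟨ψ, -, h⟩ := (SmoothBumpFunction.nhds_basis_tsupport (I := I) q₀).mem_iff.1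
    ((trivializationAt F E q₀).open_baseSet.mem_nhds (mem_baseSet_trivializationAt F E q₀))
  exact ⟨ψ, h⟩

/-- A smooth bump function at `q₀` supported in the domain of a trivialization of `E`. -/
def bump (q₀ : Q) : SmoothBumpFunction I q₀ := (exists_bump I F E q₀).choose

theorem tsupport_bump (q₀ : Q) :
    tsupport (bump I F E q₀) ⊆ (trivializationAt F E q₀).baseSet :=
  (exists_bump I F E q₀).choose_spec

/-- Global smooth sections of `E` that form a local frame near `q₀`. -/
def frame (q₀ : Q) (i : Fin (finrank ℝ F)) : Cₛ^∞⟮I; F, E⟯ :=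
  ⟨fun q => bump I F E q₀ q • (trivializationAt F E q₀).localFrame (finBasis ℝ F) i q,
    ContMDiffOn.smul_section_of_tsupport (u := (trivializationAt F E q₀).baseSet)
      (bump I F E q₀).contMDiff.contMDiffOn
      (trivializationAt F E q₀).open_baseSet (tsupport_bump I F E q₀)
      ((trivializationAt F E q₀).contMDiffOn_localFrame_baseSet ∞ (finBasis ℝ F) i)⟩

/-- The smooth functions on the total space of `E`, linear on the fibres, whose restriction to
the fibres near `q₀` is the dual basis of `frame I F E q₀`. -/
def coframe (q₀ : Q) (i : Fin (finrank ℝ F)) (a : TotalSpace F E) : ℝ :=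
  bump I F E q₀ a.proj * (finBasis ℝ F).repr (trivializationAt F E q₀ a).2 i

theorem contMDiff_coframe (q₀ : Q) (i : Fin (finrank ℝ F)) :
    ContMDiff (I.prod 𝓘(ℝ, F)) 𝓘(ℝ, ℝ) ∞ (coframe I F E q₀ i) := by
  have hc : Continuous (TotalSpace.proj : TotalSpace F E → Q) := (contMDiff_proj E (n := ∞)
    (IB := I)).continuous
  apply contMDiff_of_contMDiffOn_union_of_isOpen
    (s := (TotalSpace.proj : TotalSpace F E → Q) ⁻¹' (trivializationAt F E q₀).baseSet)
    (t := (TotalSpace.proj : TotalSpace F E → Q) ⁻¹' (tsupport (bump I F E q₀))ᶜ)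
  · apply ContMDiffOn.mul
    · exact ((bump I F E q₀).contMDiff.comp (contMDiff_proj E)).contMDiffOn
    · have h1 := (trivializationAt F E q₀).contMDiffOn (IB := I) (n := ∞)
      rw [(trivializationAt F E q₀).source_eq] at h1
      have h2 : ContMDiff 𝓘(ℝ, F) 𝓘(ℝ, ℝ) ∞ (fun v => (finBasis ℝ F).coord i v) :=
        (LinearMap.toContinuousLinearMap ((finBasis ℝ F).coord i)).contMDiff
      exact h2.comp_contMDiffOn (contMDiff_snd.comp_contMDiffOn h1)
  · apply (contMDiffOn_const (c := (0 : ℝ))).congr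
    intro a ha
    simp only [coframe]
    rw [image_eq_zero_of_notMem_tsupport ha, zero_mul]
  · rw [← preimage_union, eq_univ_iff_forall]
    intro a
    by_cases h : a.proj ∈ tsupport (bump I F E q₀)
    · exact Or.inl (tsupport_bump I F E q₀ h)
    · exact Or.inr h
  · exact (trivializationAt F E q₀).open_baseSet.preimage hc
  · exact (isClosed_tsupport _).isOpen_compl.preimage hc

variable {I F E} in
theorem sum_coframe_smul_frame (q₀ q : Q) (hq : bump I F E q₀ q = 1) (a : E q) :
    ∑ i, coframe I F E q₀ i ⟨q, a⟩ • frame I F E q₀ i q = a := by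
  have hq' : q ∈ (trivializationAt F E q₀).baseSet := by
    apply tsupport_bump I F E q₀ (subset_tsupport _ _)
    rw [Function.mem_support, hq]; exact one_ne_zero
  have h : ∀ i, coframe I F E q₀ i ⟨q, a⟩ • frame I F E q₀ i q =
      ((trivializationAt F E q₀).basisAt (finBasis ℝ F) hq').repr a i •
        (trivializationAt F E q₀).basisAt (finBasis ℝ F) hq' i := by
    intro i
    have : frame I F E q₀ i q = bump I F E q₀ q •
      (trivializationAt F E q₀).localFrame (finBasis ℝ F) i q := rfl
    rw [this, (trivializationAt F E q₀).localFrame_apply_of_mem_baseSet (finBasis ℝ F) hq', coframe]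
    simp only [hq, one_smul, one_mul]
    congr 1
  rw [Finset.sum_congr rfl (fun i _ => h i), Basis.sum_repr]

variable {I F E} in
theorem coframe_sum (q₀ q : Q) (i : Fin (finrank ℝ F)) {ι : Type*} (t : Finset ι) (a : ι → E q) :
    coframe I F E q₀ i ⟨q, ∑ k ∈ t, a k⟩ = ∑ k ∈ t, coframe I F E q₀ i ⟨q, a k⟩ := by
  by_cases hq : q ∈ (trivializationAt F E q₀).baseSet
  · have h : ∀ a : E q, coframe I F E q₀ i ⟨q, a⟩ = bump I F E q₀ q * (finBasis ℝ F).coord i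
        ((trivializationAt F E q₀).linearEquivAt ℝ q hq a) := fun _ => rfl
    simp only [h, map_sum, Finset.mul_sum]
  · have h : ∀ a : E q, coframe I F E q₀ i ⟨q, a⟩ = 0 := by
      intro a
      simp only [coframe]
      rw [image_eq_zero_of_notMem_tsupport (fun h => hq (tsupport_bump I F E q₀ h)), zero_mul]
    simp [h]

variable {I F E} in
theorem coframe_smul (q₀ q : Q) (i : Fin (finrank ℝ F)) (c : ℝ) (a : E q)
    (hq : bump I F E q₀ q = 1) :
    coframe I F E q₀ i ⟨q, c • a⟩ = c * coframe I F E q₀ i ⟨q, a⟩ := by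
  have hq' : q ∈ (trivializationAt F E q₀).baseSet := by
    apply tsupport_bump I F E q₀ (subset_tsupport _ _)
    rw [Function.mem_support, hq]; exact one_ne_zero
  have h : ∀ a : E q, coframe I F E q₀ i ⟨q, a⟩ = bump I F E q₀ q * (finBasis ℝ F).coord i
      ((trivializationAt F E q₀).linearEquivAt ℝ q hq' a) := fun _ => rfl
  simp only [h, map_smul, smul_eq_mul]
  ring

end Frame
namespace LieAlgebroid

variable {I F E} [IsManifold I ∞ Q] (𝓔 : LieAlgebroid I F E)

/-- The vector field `ρ(σ)` is smooth. -/
theorem contMDiff_anchor_section (σ : Cₛ^∞⟮I; F, E⟯) :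
    ContMDiff I I.tangent ∞ (fun q => (⟨q, 𝓔.anchor q (σ q)⟩ : TangentBundle I Q)) :=
  𝓔.contMDiff_anchor.comp σ.contMDiff

/-- The function `ρ(σ) f`. -/
def anchorDeriv (σ : Cₛ^∞⟮I; F, E⟯) (f : C^∞⟮I, Q; ℝ⟯) : C^∞⟮I, Q; ℝ⟯ :=
  ⟨fun q => mvfderiv I f q (𝓔.anchor q (σ q)),
    contMDiff_mvfderiv_apply f f.contMDiff _ (𝓔.contMDiff_anchor_section σ)⟩

theorem leibniz' (σ τ : Cₛ^∞⟮I; F, E⟯) (f : C^∞⟮I, Q; ℝ⟯) :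
    𝓔.bracket σ (smulSection f τ) =
      smulSection f (𝓔.bracket σ τ) + smulSection (𝓔.anchorDeriv σ f) τ := by
  ext q
  exact 𝓔.leibniz σ τ f q

theorem bracket_add_right (σ τ υ : Cₛ^∞⟮I; F, E⟯) :
    𝓔.bracket σ (τ + υ) = 𝓔.bracket σ τ + 𝓔.bracket σ υ := by
  rw [𝓔.bracket_skew, 𝓔.bracket_add_left, 𝓔.bracket_skew τ, 𝓔.bracket_skew υ]
  abel

theorem bracket_smul_right (c : ℝ) (σ τ : Cₛ^∞⟮I; F, E⟯) :
    𝓔.bracket σ (c • τ) = c • 𝓔.bracket σ τ := by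
  rw [𝓔.bracket_skew, 𝓔.bracket_smul_left, 𝓔.bracket_skew τ, smul_neg, neg_neg]

theorem bracket_bracket (σ τ υ : Cₛ^∞⟮I; F, E⟯) :
    𝓔.bracket (𝓔.bracket σ τ) υ =
      𝓔.bracket σ (𝓔.bracket τ υ) - 𝓔.bracket τ (𝓔.bracket σ υ) := by
  have h := 𝓔.jacobi σ τ υ
  rw [𝓔.bracket_skew υ σ, 𝓔.bracket_skew υ (𝓔.bracket σ τ)] at h
  have h2 : 𝓔.bracket τ (-𝓔.bracket σ υ) = -𝓔.bracket τ (𝓔.bracket σ υ) := by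
    have := 𝓔.bracket_smul_right (-1) τ (𝓔.bracket σ υ)
    simpa using this
  rw [h2] at h
  rw [← sub_eq_zero, ← neg_eq_zero, ← h]
  abel

/-- The anchor is a homomorphism of Lie algebras: `ρ[σ, τ] f = ρ(σ)ρ(τ) f - ρ(τ)ρ(σ) f`. -/
theorem anchorDeriv_bracket (σ τ : Cₛ^∞⟮I; F, E⟯) (f : C^∞⟮I, Q; ℝ⟯) (q : Q) :
    𝓔.anchorDeriv (𝓔.bracket σ τ) f q =
      𝓔.anchorDeriv σ (𝓔.anchorDeriv τ f) q - 𝓔.anchorDeriv τ (𝓔.anchorDeriv σ f) q := by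
  by_cases hυ : ∃ υ : Cₛ^∞⟮I; F, E⟯, υ q ≠ 0
  · obtain ⟨υ, hυ⟩ := hυ
    have h := 𝓔.bracket_bracket σ τ (smulSection f υ)
    rw [𝓔.leibniz', 𝓔.leibniz', 𝓔.leibniz' σ, 𝓔.bracket_add_right, 𝓔.bracket_add_right,
      𝓔.leibniz', 𝓔.leibniz', 𝓔.leibniz', 𝓔.leibniz', 𝓔.bracket_bracket] at h
    have h2 := congrArg (fun s : Cₛ^∞⟮I; F, E⟯ => s q) h
    simp only [smulSection, ContMDiffSection.coe_add, ContMDiffSection.coe_sub, Pi.add_apply,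
      Pi.sub_apply, ContMDiffSection.coeFn_mk] at h2
    have h3 : (𝓔.anchorDeriv (𝓔.bracket σ τ) f q - (𝓔.anchorDeriv σ (𝓔.anchorDeriv τ f) q -
        𝓔.anchorDeriv τ (𝓔.anchorDeriv σ f) q)) • υ q = 0 := by
      rw [← sub_eq_zero] at h2
      rw [← h2]
      module
    exact sub_eq_zero.1 ((smul_eq_zero.1 h3).resolve_right hυ)
  · push Not at hυ
    have h0 : ∀ (σ : Cₛ^∞⟮I; F, E⟯) (f : C^∞⟮I, Q; ℝ⟯), 𝓔.anchorDeriv σ f q = 0 := by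
      intro σ f
      change mvfderiv I f q (𝓔.anchor q (σ q)) = 0
      rw [hυ, map_zero, map_zero]
    simp [h0]

section Locality

variable [FiniteDimensional ℝ EQ] [T2Space Q]

/-- The bracket is local. -/
theorem bracket_congr_right (τ s s' : Cₛ^∞⟮I; F, E⟯) (q : Q) (h : ∀ᶠ q' in 𝓝 q, s q' = s' q') :
    𝓔.bracket τ s q = 𝓔.bracket τ s' q := by
  obtain ⟨ψ, -, hψ⟩ := (SmoothBumpFunction.nhds_basis_tsupport (I := I) q).mem_iff.1 h
  let f : C^∞⟮I, Q; ℝ⟯ := ⟨ψ, ψ.contMDiff⟩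
  have e : smulSection f s = smulSection f s' := by
    ext q'
    change ψ q' • s q' = ψ q' • s' q'
    by_cases hq : q' ∈ tsupport ψ
    · rw [show s q' = s' q' from hψ hq]
    · rw [image_eq_zero_of_notMem_tsupport hq, zero_smul, zero_smul]
  have h1 := 𝓔.leibniz τ s f q
  have h2 := 𝓔.leibniz τ s' f q
  have hf : f q = 1 := ψ.eq_one
  rw [hf, one_smul] at h1 h2
  rw [e, h2, h.self_of_nhds] at h1
  exact (add_right_cancel h1).symm

theorem sum_section_apply {ι : Type*} (t : Finset ι) (s : ι → Cₛ^∞⟮I; F, E⟯) (q : Q) :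
    (∑ i ∈ t, s i) q = ∑ i ∈ t, s i q := by
  classical
  induction t using Finset.induction_on with
  | empty => rfl
  | insert i t hi ih =>
    rw [Finset.sum_insert hi, Finset.sum_insert hi, ContMDiffSection.coe_add, Pi.add_apply, ih]

theorem bracket_sum_right {ι : Type*} (t : Finset ι) (τ : Cₛ^∞⟮I; F, E⟯)
    (s : ι → Cₛ^∞⟮I; F, E⟯) :
    𝓔.bracket τ (∑ i ∈ t, s i) = ∑ i ∈ t, 𝓔.bracket τ (s i) := by
  classical
  induction t using Finset.induction_on with
  | empty =>
    have := 𝓔.bracket_smul_right 0 τ 0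
    simpa using this
  | insert i t hi ih =>
    rw [Finset.sum_insert hi, Finset.sum_insert hi, 𝓔.bracket_add_right, ih]

end Locality

variable {EP : Type*} [NormedAddCommGroup EP] [NormedSpace ℝ EP]
  {HP : Type*} [TopologicalSpace HP] (IP : ModelWithCorners ℝ EP HP)
  {P : Type*} [TopologicalSpace P] [ChartedSpace HP P] [IsManifold IP ∞ P]

/-- The fibre of the prolongation over `pr : P → Q` at `p`: the pairs `(a, v)` with
`a ∈ E_{pr(p)}`, `v ∈ T_p P` and `ρ(a) = Tpr(v)`. -/
def prolongation (pr : P → Q) (p : P) : Submodule ℝ (E (pr p) × TangentSpace IP p) where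
  carrier := {x | 𝓔.anchor (pr p) x.1 = mfderiv IP I pr p x.2}
  add_mem' {x y} hx hy := by
    change 𝓔.anchor (pr p) (x + y).1 = mfderiv IP I pr p (x + y).2
    rw [Prod.fst_add, Prod.snd_add, map_add, map_add, hx, hy]
  zero_mem' := by simp
  smul_mem' c x hx := by
    change 𝓔.anchor (pr p) (c • x).1 = mfderiv IP I pr p (c • x).2
    rw [Prod.smul_fst, Prod.smul_snd, map_smul, map_smul, hx]

/-- Smooth sections of the prolongation, as pairs of a smooth section of `E` along `pr` and
a smooth vector field on `P`. -/
structure ProlongationSection (pr : P → Q) where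
  fst : ∀ p : P, E (pr p)
  vec : ∀ p : P, TangentSpace IP p
  contMDiff_fst : ContMDiff IP (I.prod 𝓘(ℝ, F)) ∞ (fun p => (⟨pr p, fst p⟩ : TotalSpace F E))
  contMDiff_vec : ContMDiff IP IP.tangent ∞ (fun p => (⟨p, vec p⟩ : TangentBundle IP P))
  anchor_fst : ∀ p, 𝓔.anchor (pr p) (fst p) = mfderiv IP I pr p (vec p)

namespace ProlongationSection

variable {𝓔 IP} {pr : P → Q}

/-- The section as a map into the fibres of the prolongation. -/
def eval (Z : 𝓔.ProlongationSection IP pr) (p : P) : 𝓔.prolongation IP pr p :=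
  ⟨(Z.fst p, Z.vec p), Z.anchor_fst p⟩

variable [FiniteDimensional ℝ EQ] [T2Space Q] [FiniteDimensional ℝ F] [ContMDiffVectorBundle ∞ F E I]

/-- The coefficients of the `E`-component of a section in the frame of `E` near `q₀`. -/
def coeff (Z : 𝓔.ProlongationSection IP pr) (q₀ : Q) (i : Fin (finrank ℝ F)) (p : P) : ℝ :=
  coframe I F E q₀ i ⟨pr p, Z.fst p⟩

theorem contMDiff_coeff (Z : 𝓔.ProlongationSection IP pr) (q₀ : Q) (i : Fin (finrank ℝ F)) :
    ContMDiff IP 𝓘(ℝ, ℝ) ∞ (Z.coeff q₀ i) :=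
  (contMDiff_coframe I F E q₀ i).comp Z.contMDiff_fst

/-- If `Z₁ = (Σᵢ fᵢ eᵢ, X₁)` and `Z₂ = (Σⱼ gⱼ eⱼ, X₂)` in the frame `e` near `q₀`, this is
`Σᵢⱼ fᵢ gⱼ [eᵢ, eⱼ] + Σⱼ X₁(gⱼ) eⱼ - Σᵢ X₂(fᵢ) eᵢ`. -/
def bracketFst (Z₁ Z₂ : 𝓔.ProlongationSection IP pr) (q₀ : Q) (p : P) : E (pr p) :=
  (∑ i, ∑ j, (Z₁.coeff q₀ i p * Z₂.coeff q₀ j p) •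
      𝓔.bracket (frame I F E q₀ i) (frame I F E q₀ j) (pr p)) +
    (∑ j, mvfderiv IP (Z₂.coeff q₀ j) p (Z₁.vec p) • frame I F E q₀ j (pr p)) -
    ∑ i, mvfderiv IP (Z₁.coeff q₀ i) p (Z₂.vec p) • frame I F E q₀ i (pr p)

theorem mvfderiv_comp_proj (hpr : ContMDiff IP I ∞ pr) (Z : 𝓔.ProlongationSection IP pr) (q₀ : Q)
    (f : C^∞⟮I, Q; ℝ⟯) (p : P) (hp : bump I F E q₀ (pr p) = 1) :
    mvfderiv IP (f ∘ pr) p (Z.vec p) =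
      ∑ i, Z.coeff q₀ i p * 𝓔.anchorDeriv (frame I F E q₀ i) f (pr p) := by
  rw [mvfderiv_comp_apply p ((f.contMDiff _).mdifferentiableAt (by simp))
    ((hpr p).mdifferentiableAt (by simp)), ← Z.anchor_fst]
  conv_lhs => rw [← sum_coframe_smul_frame q₀ (pr p) hp (Z.fst p)]
  simp only [map_sum, map_smul, smul_eq_mul]
  rfl

theorem anchor_bracketFst [I.Boundaryless] [FiniteDimensional ℝ EP] [IP.Boundaryless]
    (hpr : ContMDiff IP I ∞ pr) (Z₁ Z₂ : 𝓔.ProlongationSection IP pr)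
    (q₀ : Q) (p : P) (hp : ∀ᶠ q in 𝓝 (pr p), bump I F E q₀ q = 1) :
    𝓔.anchor (pr p) (bracketFst Z₁ Z₂ q₀ p) =
      mfderiv IP I pr p (mlieBracket IP Z₁.vec Z₂.vec p) := by
  have := FiniteDimensional.complete ℝ EP
  apply tangent_ext
  intro h hh
  let f : C^∞⟮I, Q; ℝ⟯ := ⟨h, hh⟩
  have hd : ∀ {g : P → ℝ}, ContMDiff IP 𝓘(ℝ, ℝ) ∞ g → ∀ p, MDifferentiableAt IP 𝓘(ℝ, ℝ) g p :=
    fun hg p => (hg p).mdifferentiableAt (by simp)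
  have hfpr : ContMDiff IP 𝓘(ℝ, ℝ) ∞ (f ∘ pr) := f.contMDiff.comp hpr
  have hnear : ∀ᶠ p' in 𝓝 p, bump I F E q₀ (pr p') = 1 :=
    hpr.continuous.continuousAt.eventually hp
  have hder : ∀ Z Z' : 𝓔.ProlongationSection IP pr,
      mvfderiv IP (fun y => mvfderiv IP (f ∘ pr) y (Z'.vec y)) p (Z.vec p) =
        ∑ j, (mvfderiv IP (Z'.coeff q₀ j) p (Z.vec p) *
              𝓔.anchorDeriv (frame I F E q₀ j) f (pr p) +
            Z'.coeff q₀ j p * ∑ i, Z.coeff q₀ i p *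
              𝓔.anchorDeriv (frame I F E q₀ i) (𝓔.anchorDeriv (frame I F E q₀ j) f) (pr p)) := by
    intro Z Z'
    have hev : (fun y => mvfderiv IP (f ∘ pr) y (Z'.vec y)) =ᶠ[𝓝 p]
        fun y => ∑ j, Z'.coeff q₀ j y * (𝓔.anchorDeriv (frame I F E q₀ j) f ∘ pr) y := by
      filter_upwards [hnear] with y hy
      exact mvfderiv_comp_proj hpr Z' q₀ f y hy
    rw [mvfderiv_congr hev, mvfderiv_finset_sum, _root_.sum_apply]
    · refine Finset.sum_congr rfl fun j _ => ?_
      have hF : ContMDiff IP 𝓘(ℝ, ℝ) ∞ (𝓔.anchorDeriv (frame I F E q₀ j) f ∘ pr) :=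
        (𝓔.anchorDeriv (frame I F E q₀ j) f).contMDiff.comp hpr
      have hm := mvfderiv_mul (hd (Z'.contMDiff_coeff q₀ j) p) (hd hF p)
      have hm' := congrArg (fun T => T (Z.vec p)) hm
      have hp0 := mvfderiv_comp_proj hpr Z q₀ (𝓔.anchorDeriv (frame I F E q₀ j) f) p hp.self_of_nhds
      rw [← hp0]
      refine hm'.trans ?_
      simp only [_root_.add_apply, _root_.smul_apply, smul_eq_mul,
        Function.comp_apply]
      ring
    · exact fun j => hd ((Z'.contMDiff_coeff q₀ j).mul
        ((𝓔.anchorDeriv (frame I F E q₀ j) f).contMDiff.comp hpr)) p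
  have hcomm := mvfderiv_mlieBracket p (f ∘ pr) hfpr Z₁.vec Z₂.vec Z₁.contMDiff_vec
    Z₂.contMDiff_vec (hd (contMDiff_mvfderiv_apply _ hfpr _ Z₁.contMDiff_vec) p)
    (hd (contMDiff_mvfderiv_apply _ hfpr _ Z₂.contMDiff_vec) p)
  rw [hder, hder, mvfderiv_comp_apply p ((f.contMDiff _).mdifferentiableAt (by simp))
    ((hpr p).mdifferentiableAt (by simp))] at hcomm
  refine Eq.trans ?_ hcomm.symm
  have hb : ∀ σ : Cₛ^∞⟮I; F, E⟯,
      mvfderiv I h (pr p) (𝓔.anchor (pr p) (σ (pr p))) = 𝓔.anchorDeriv σ f (pr p) := fun _ => rfl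
  simp only [bracketFst, map_add, map_sub, map_sum, map_smul, smul_eq_mul, hb,
    𝓔.anchorDeriv_bracket, mul_sub, Finset.sum_sub_distrib, Finset.sum_add_distrib, Finset.mul_sum]
  have hs : ∀ (a b : Fin (finrank ℝ F) → ℝ) (c : Fin (finrank ℝ F) → Fin (finrank ℝ F) → ℝ),
      ∑ i, ∑ j, a i * b j * c i j = ∑ j, ∑ i, b j * (a i * c i j) := by
    intro a b c
    rw [Finset.sum_comm]
    exact Finset.sum_congr rfl fun j _ => Finset.sum_congr rfl fun i _ => by ring
  have hs' : ∀ (a b : Fin (finrank ℝ F) → ℝ) (c : Fin (finrank ℝ F) → Fin (finrank ℝ F) → ℝ),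
      ∑ i, ∑ j, a i * b j * c j i = ∑ i, ∑ j, a i * (b j * c j i) := by
    intro a b c
    exact Finset.sum_congr rfl fun j _ => Finset.sum_congr rfl fun i _ => by ring
  rw [hs (fun i => Z₁.coeff q₀ i p) (fun i => Z₂.coeff q₀ i p)
      (fun i j => 𝓔.anchorDeriv (frame I F E q₀ i) (𝓔.anchorDeriv (frame I F E q₀ j) f) (pr p)),
    hs' (fun i => Z₁.coeff q₀ i p) (fun i => Z₂.coeff q₀ i p)
      (fun i j => 𝓔.anchorDeriv (frame I F E q₀ i) (𝓔.anchorDeriv (frame I F E q₀ j) f) (pr p))]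
  ring

theorem fst_eq (Z : 𝓔.ProlongationSection IP pr) (q₀ : Q) (p : P)
    (hp : bump I F E q₀ (pr p) = 1) :
    Z.fst p = ∑ i, Z.coeff q₀ i p • frame I F E q₀ i (pr p) :=
  (sum_coframe_smul_frame q₀ (pr p) hp (Z.fst p)).symm

/-- The transition functions between two frames. -/
def transition (q₀ q₁ : Q) (a i : Fin (finrank ℝ F)) : C^∞⟮I, Q; ℝ⟯ :=
  ⟨fun q => coframe I F E q₀ i ⟨q, frame I F E q₁ a q⟩,
    (contMDiff_coframe I F E q₀ i).comp (frame I F E q₁ a).contMDiff⟩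

theorem coeff_eq_sum (Z : 𝓔.ProlongationSection IP pr) (q₀ q₁ : Q) (i : Fin (finrank ℝ F)) (p : P)
    (h₀ : bump I F E q₀ (pr p) = 1) (h₁ : bump I F E q₁ (pr p) = 1) :
    Z.coeff q₀ i p = ∑ a, Z.coeff q₁ a p * transition (I := I) (F := F) (E := E) q₀ q₁ a i (pr p) := by
  have e : Z.coeff q₀ i p = coframe I F E q₀ i ⟨pr p, Z.fst p⟩ := rfl
  rw [e, Z.fst_eq q₁ p h₁, coframe_sum]
  exact Finset.sum_congr rfl fun a _ => coframe_smul _ _ _ _ _ h₀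

/-- One half of the formula for the bracket does not depend on the frame. -/
theorem half_bracket_eq (hpr : ContMDiff IP I ∞ pr) (Z : 𝓔.ProlongationSection IP pr) (q₀ q₁ : Q) (p : P)
    (h₀ : ∀ᶠ q in 𝓝 (pr p), bump I F E q₀ q = 1) (h₁ : ∀ᶠ q in 𝓝 (pr p), bump I F E q₁ q = 1)
    (τ : Cₛ^∞⟮I; F, E⟯) (X : TangentSpace IP p)
    (hX : 𝓔.anchor (pr p) (τ (pr p)) = mfderiv IP I pr p X) :
    (∑ i, Z.coeff q₁ i p • 𝓔.bracket (frame I F E q₁ i) τ (pr p)) -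
      ∑ i, mvfderiv IP (Z.coeff q₁ i) p X • frame I F E q₁ i (pr p) =
    (∑ i, Z.coeff q₀ i p • 𝓔.bracket (frame I F E q₀ i) τ (pr p)) -
      ∑ i, mvfderiv IP (Z.coeff q₀ i) p X • frame I F E q₀ i (pr p) := by
  let A : Fin (finrank ℝ F) → Fin (finrank ℝ F) → C^∞⟮I, Q; ℝ⟯ := transition (E := E) q₀ q₁
  have hd : ∀ {g : P → ℝ}, ContMDiff IP 𝓘(ℝ, ℝ) ∞ g → MDifferentiableAt IP 𝓘(ℝ, ℝ) g p :=
    fun hg => (hg p).mdifferentiableAt (by simp)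
  have hA : ∀ a, ∀ᶠ q in 𝓝 (pr p), frame I F E q₁ a q = ∑ i, A a i q • frame I F E q₀ i q := by
    intro a
    filter_upwards [h₀] with q hq
    exact (sum_coframe_smul_frame q₀ q hq _).symm
  have hbr : ∀ a, 𝓔.bracket (frame I F E q₁ a) τ (pr p) =
      ∑ i, (A a i (pr p) • 𝓔.bracket (frame I F E q₀ i) τ (pr p) -
        𝓔.anchorDeriv τ (A a i) (pr p) • frame I F E q₀ i (pr p)) := by
    intro a
    rw [𝓔.bracket_skew, ContMDiffSection.coe_neg, Pi.neg_apply,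
      𝓔.bracket_congr_right τ (frame I F E q₁ a)
      (∑ i, smulSection (A a i) (frame I F E q₀ i)) (pr p) (by
        filter_upwards [hA a] with q hq
        rw [hq, sum_section_apply]
        rfl), 𝓔.bracket_sum_right, sum_section_apply, ← Finset.sum_neg_distrib]
    refine Finset.sum_congr rfl fun i _ => ?_
    rw [𝓔.leibniz', 𝓔.bracket_skew τ]
    change -(A a i (pr p) • -(𝓔.bracket (frame I F E q₀ i) τ (pr p)) +
      𝓔.anchorDeriv τ (A a i) (pr p) • frame I F E q₀ i (pr p)) = _
    module
  have hco : ∀ i, Z.coeff q₀ i =ᶠ[𝓝 p] fun p' => ∑ a, Z.coeff q₁ a p' * (A a i ∘ pr) p' := by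
    intro i
    filter_upwards [hpr.continuous.continuousAt.eventually h₀,
      hpr.continuous.continuousAt.eventually h₁] with p' h h'
    exact Z.coeff_eq_sum q₀ q₁ i p' h h'
  have hder : ∀ i, mvfderiv IP (Z.coeff q₀ i) p X = ∑ a, (mvfderiv IP (Z.coeff q₁ a) p X *
      A a i (pr p) + Z.coeff q₁ a p * 𝓔.anchorDeriv τ (A a i) (pr p)) := by
    intro i
    rw [mvfderiv_congr (hco i), mvfderiv_finset_sum, _root_.sum_apply]
    · refine Finset.sum_congr rfl fun a _ => ?_
      have hm := mvfderiv_mul (hd (Z.contMDiff_coeff q₁ a)) (hd ((A a i).contMDiff.comp hpr))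
      have hm' := congrArg (fun T => T X) hm
      refine hm'.trans ?_
      have h3 : mvfderiv IP (A a i ∘ pr) p X = 𝓔.anchorDeriv τ (A a i) (pr p) := by
        rw [mvfderiv_comp_apply p (((A a i).contMDiff _).mdifferentiableAt (by simp))
          ((hpr p).mdifferentiableAt (by simp)), ← hX]
        rfl
      simp only [_root_.add_apply, _root_.smul_apply, smul_eq_mul, Function.comp_apply]
      rw [h3]
      ring
    · exact fun a => hd ((Z.contMDiff_coeff q₁ a).mul ((A a i).contMDiff.comp hpr))
  have hc0 : ∀ i, Z.coeff q₀ i p = ∑ a, Z.coeff q₁ a p * A a i (pr p) :=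
    fun i => (hco i).self_of_nhds
  simp only [hbr, hder, hc0]
  have hA0 : ∀ a, frame I F E q₁ a (pr p) = ∑ i, A a i (pr p) • frame I F E q₀ i (pr p) :=
    fun a => (hA a).self_of_nhds
  simp only [hA0, Finset.smul_sum, Finset.sum_smul]
  rw [← Finset.sum_sub_distrib, Finset.sum_comm (f := fun i a =>
    (Z.coeff q₁ a p * A a i (pr p)) • 𝓔.bracket (frame I F E q₀ i) τ (pr p)),
    Finset.sum_comm (f := fun i a => (mvfderiv IP (Z.coeff q₁ a) p X *
      A a i (pr p) + Z.coeff q₁ a p * 𝓔.anchorDeriv τ (A a i) (pr p)) • frame I F E q₀ i (pr p)),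
    ← Finset.sum_sub_distrib]
  refine Finset.sum_congr rfl fun a _ => ?_
  rw [← Finset.sum_sub_distrib, ← Finset.sum_sub_distrib]
  refine Finset.sum_congr rfl fun i _ => ?_
  module

/-- The formula for the bracket does not depend on the frame. -/
theorem bracketFst_frame (hpr : ContMDiff IP I ∞ pr) (Z₁ Z₂ : 𝓔.ProlongationSection IP pr)
    (q₀ q₁ : Q) (p : P)
    (h₀ : ∀ᶠ q in 𝓝 (pr p), bump I F E q₀ q = 1) (h₁ : ∀ᶠ q in 𝓝 (pr p), bump I F E q₁ q = 1) :
    bracketFst Z₁ Z₂ q₁ p = bracketFst Z₁ Z₂ q₀ p := by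
  let τ : ∀ (_ : 𝓔.ProlongationSection IP pr) (_ : Q), Cₛ^∞⟮I; F, E⟯ := fun Z q =>
    ∑ j, Z.coeff q j p • frame I F E q j
  have hτ : ∀ (Z : 𝓔.ProlongationSection IP pr) (q : Q), bump I F E q (pr p) = 1 →
      𝓔.anchor (pr p) (τ Z q (pr p)) = mfderiv IP I pr p (Z.vec p) := by
    intro Z q hq
    rw [sum_section_apply, ← Z.anchor_fst, Z.fst_eq q p hq]
    rfl
  have hbr : ∀ (Z : 𝓔.ProlongationSection IP pr) (q : Q) (σ : Cₛ^∞⟮I; F, E⟯),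
      𝓔.bracket σ (τ Z q) (pr p) = ∑ j, Z.coeff q j p • 𝓔.bracket σ (frame I F E q j) (pr p) := by
    intro Z q σ
    rw [𝓔.bracket_sum_right, sum_section_apply]
    refine Finset.sum_congr rfl fun j _ => ?_
    rw [𝓔.bracket_smul_right]
    rfl
  have e1 := half_bracket_eq hpr Z₁ q₀ q₁ p h₀ h₁ (τ Z₂ q₁) (Z₂.vec p) (hτ Z₂ q₁ h₁.self_of_nhds)
  have e2 := half_bracket_eq hpr Z₂ q₀ q₁ p h₀ h₁ (τ Z₁ q₀) (Z₁.vec p) (hτ Z₁ q₀ h₀.self_of_nhds)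
  have sw : ∀ q q', (∑ i, Z₂.coeff q i p • 𝓔.bracket (frame I F E q i) (τ Z₁ q') (pr p)) =
      -∑ i, Z₁.coeff q' i p • 𝓔.bracket (frame I F E q' i) (τ Z₂ q) (pr p) := by
    intro q q'
    simp only [hbr, Finset.smul_sum]
    rw [Finset.sum_comm, ← Finset.sum_neg_distrib]
    refine Finset.sum_congr rfl fun j _ => ?_
    rw [← Finset.sum_neg_distrib]
    refine Finset.sum_congr rfl fun i _ => ?_
    rw [𝓔.bracket_skew, ContMDiffSection.coe_neg, Pi.neg_apply, smul_neg, smul_neg, smul_comm]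
  have hb : ∀ q, bracketFst Z₁ Z₂ q p =
      (∑ i, Z₁.coeff q i p • 𝓔.bracket (frame I F E q i) (τ Z₂ q) (pr p)) +
    (∑ j, mvfderiv IP (Z₂.coeff q j) p (Z₁.vec p) • frame I F E q j (pr p)) -
    ∑ i, mvfderiv IP (Z₁.coeff q i) p (Z₂.vec p) • frame I F E q i (pr p) := by
    intro q
    simp only [bracketFst, hbr, Finset.smul_sum, smul_smul]
  rw [hb, hb]
  rw [sw, sw] at e2
  rw [add_sub_right_comm, e1, add_sub_right_comm]
  have e2' := congrArg Neg.neg e2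
  simp only [neg_sub, sub_neg_eq_add] at e2'
  rw [add_comm, add_comm (∑ i, mvfderiv IP (Z₂.coeff q₀ i) p (Z₁.vec p) • _)] at e2'
  rw [sub_add_eq_add_sub, sub_add_eq_add_sub, add_comm, add_comm (∑ i, Z₁.coeff q₀ i p • _),
    sub_left_inj]
  rw [add_comm, add_comm (∑ i, mvfderiv IP (Z₂.coeff q₀ i) p (Z₁.vec p) • _)]
  exact e2'

theorem eventually_bump_eq_one (q₀ : Q) : ∀ᶠ q in 𝓝 q₀, bump I F E q₀ q = 1 :=
  (bump I F E q₀).eventuallyEq_one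

theorem contMDiffAt_bracketFst (hpr : ContMDiff IP I ∞ pr) (Z₁ Z₂ : 𝓔.ProlongationSection IP pr)
    (q₀ : Q) (p₀ : P) : ContMDiffAt IP (I.prod 𝓘(ℝ, F)) ∞
      (fun p => (⟨pr p, bracketFst Z₁ Z₂ q₀ p⟩ : TotalSpace F E)) p₀ := by
  rw [contMDiffAt_totalSpace]
  refine ⟨hpr p₀, ?_⟩
  let e := trivializationAt F E (pr p₀)
  have hσ : ∀ σ : Cₛ^∞⟮I; F, E⟯, ContMDiffAt IP 𝓘(ℝ, F) ∞
      (fun p => e.linearMapAt ℝ (pr p) (σ (pr p))) p₀ := by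
    intro σ
    have h1 := (contMDiffAt_totalSpace.1 ((σ.contMDiff.comp hpr) p₀)).2
    refine h1.congr_of_eventuallyEq ?_
    filter_upwards [hpr.continuous.continuousAt.eventually
      (e.open_baseSet.mem_nhds (mem_baseSet_trivializationAt F E (pr p₀)))] with p hp
    have hp' : pr p ∈ e.baseSet := hp
    rw [e.linearMapAt_apply, if_pos hp']
    rfl
  have hc := fun (Z : 𝓔.ProlongationSection IP pr) i => Z.contMDiff_coeff q₀ i
  have hdc := fun (Z Z' : 𝓔.ProlongationSection IP pr) i =>
    contMDiff_mvfderiv_apply _ (hc Z i) _ Z'.contMDiff_vec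
  have h2 : ContMDiffAt IP 𝓘(ℝ, F) ∞
      (fun p => e.linearMapAt ℝ (pr p) (bracketFst Z₁ Z₂ q₀ p)) p₀ := by
    simp only [bracketFst, map_add, map_sub, map_sum, map_smul]
    refine ContMDiffAt.sub (ContMDiffAt.add ?_ ?_) ?_
    · refine contMDiffAt_finsetSum fun i _ => contMDiffAt_finsetSum fun j _ => ?_
      exact (((hc Z₁ i).mul (hc Z₂ j)) p₀).smul (hσ _)
    · exact contMDiffAt_finsetSum fun j _ => ((hdc Z₂ Z₁ j) p₀).smul (hσ _)
    · exact contMDiffAt_finsetSum fun j _ => ((hdc Z₁ Z₂ j) p₀).smul (hσ _)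
  refine h2.congr_of_eventuallyEq ?_
  filter_upwards [hpr.continuous.continuousAt.eventually
    (e.open_baseSet.mem_nhds (mem_baseSet_trivializationAt F E (pr p₀)))] with p hp
  have hp' : pr p ∈ e.baseSet := hp
  rw [e.linearMapAt_apply, if_pos hp']

variable [I.Boundaryless] [FiniteDimensional ℝ EP] [IP.Boundaryless]

/-- The Lie bracket of two sections of the prolongation. -/
def bracket (hpr : ContMDiff IP I ∞ pr) (Z₁ Z₂ : 𝓔.ProlongationSection IP pr) :
    𝓔.ProlongationSection IP pr where
  fst p := bracketFst Z₁ Z₂ (pr p) p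
  vec p := mlieBracket IP Z₁.vec Z₂.vec p
  contMDiff_fst := by
    intro p₀
    refine (contMDiffAt_bracketFst hpr Z₁ Z₂ (pr p₀) p₀).congr_of_eventuallyEq ?_
    filter_upwards [hpr.continuous.continuousAt.eventually
      (eventually_bump_eq_one (I := I) (F := F) (E := E) (pr p₀)).eventually_nhds] with p hp
    rw [bracketFst_frame hpr Z₁ Z₂ (pr p₀) (pr p) p hp (eventually_bump_eq_one _)]
  contMDiff_vec := by
    have := FiniteDimensional.complete ℝ EP
    have : IsManifold IP (minSmoothness ℝ 2) P := by
      rw [minSmoothness_of_isRCLikeNormedField]; infer_instance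
    have : IsManifold IP (((⊤ : ℕ∞) : ℕ∞ω) + 1) P := by
      rw [show (((⊤ : ℕ∞) : ℕ∞ω) + 1) = ∞ from rfl]; infer_instance
    intro p
    exact ContMDiffAt.mlieBracket_vectorField (m := ⊤) (n := ⊤) (Z₁.contMDiff_vec p)
      (Z₂.contMDiff_vec p) (by simp)
  anchor_fst p := anchor_bracketFst hpr Z₁ Z₂ (pr p) p (eventually_bump_eq_one _)

end ProlongationSection

end LieAlgebroid
namespace LieAlgebroid

variable {I F E} [IsManifold I ∞ Q] (𝓔 : LieAlgebroid I F E)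

/-- The Lie algebroid `E`, with its space of smooth sections. -/
def data : BracketData I E where
  Sec := Cₛ^∞⟮I; F, E⟯
  eval σ q := σ q
  anchor := 𝓔.anchor
  bracket := 𝓔.bracket

/-- The differential `d^E f` of a function, `(d^E f)(a) = ρ(a) f`. -/
def differential (f : C^∞⟮I, Q; ℝ⟯) (q : Q) : E q →ₗ[ℝ] ℝ :=
  (mvfderiv I f q).toLinearMap ∘ₗ 𝓔.anchor q

/-- The prolongation of `E` over `pr : P → Q`. Its anchor is the projection `(a, v) ↦ v`. -/
def prolongationData {EP : Type*} [NormedAddCommGroup EP] [NormedSpace ℝ EP]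
    [FiniteDimensional ℝ EQ] [T2Space Q] [FiniteDimensional ℝ F] [ContMDiffVectorBundle ∞ F E I]
    [I.Boundaryless]
    {HP : Type*} [TopologicalSpace HP] (IP : ModelWithCorners ℝ EP HP)
    {P : Type*} [TopologicalSpace P] [ChartedSpace HP P] [IsManifold IP ∞ P]
    [FiniteDimensional ℝ EP] [IP.Boundaryless] {pr : P → Q} (hpr : ContMDiff IP I ∞ pr) :
    BracketData IP (fun p => 𝓔.prolongation IP pr p) where
  Sec := 𝓔.ProlongationSection IP pr
  eval Z := Z.eval
  anchor p := LinearMap.snd ℝ _ _ ∘ₗ (𝓔.prolongation IP pr p).subtype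
  bracket := ProlongationSection.bracket hpr

end LieAlgebroid

/-! ### The bundle `E* × ℝ` and its contact section -/

section Contact

/-- The fibres of the dual bundle `E*`. -/
abbrev DualFiber (q : Q) : Type _ := E q →L[ℝ] Trivial Q ℝ q

/-- The manifold `E* × ℝ`. -/
abbrev DualR : Type _ := TotalSpace (F →L[ℝ] ℝ) (DualFiber E) × ℝ

/-- The model of the manifold `E* × ℝ`. -/
abbrev dualModel : ModelWithCorners ℝ ((EQ × (F →L[ℝ] ℝ)) × ℝ)
    (ModelProd (ModelProd HQ (F →L[ℝ] ℝ)) ℝ) :=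
  (I.prod 𝓘(ℝ, F →L[ℝ] ℝ)).prod 𝓘(ℝ, ℝ)

variable [∀ q, IsTopologicalAddGroup (E q)] [∀ q, ContinuousSMul ℝ (E q)]
  [IsManifold I ∞ Q] [ContMDiffVectorBundle ∞ F E I]

variable {F E} in
/-- The projection `E* × ℝ → Q`. -/
def dualProj (p : DualR F E) : Q := p.1.proj

theorem contMDiff_dualProj : ContMDiff (dualModel I F) I ∞ (dualProj : DualR F E → Q) :=
  (contMDiff_proj (DualFiber E)).comp contMDiff_fst

variable {I F E}

/-- The section `γ = (γ₀, γₛ)` of `E* × ℝ → Q` with components `γ₀ ∈ Γ(E*)` and `γₛ ∈ C^∞(Q)`. -/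
def dualSection (γ₀ : Cₛ^∞⟮I; F →L[ℝ] ℝ, DualFiber E⟯) (γs : C^∞⟮I, Q; ℝ⟯) (q : Q) : DualR F E :=
  (⟨q, γ₀ q⟩, γs q)

theorem contMDiff_dualSection (γ₀ : Cₛ^∞⟮I; F →L[ℝ] ℝ, DualFiber E⟯) (γs : C^∞⟮I, Q; ℝ⟯) :
    ContMDiff I (dualModel I F) ∞ (dualSection γ₀ γs) :=
  γ₀.contMDiff.prodMk γs.contMDiff

namespace LieAlgebroid

variable (𝓔 : LieAlgebroid I F E)

/-- The fibres of the prolongation of `E` over `E* × ℝ → Q`. -/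
abbrev contactProlongation (p : DualR F E) :
    Submodule ℝ (E (dualProj p) × TangentSpace (dualModel I F) p) :=
  𝓔.prolongation (dualModel I F) dualProj p

/-- The prolongation of `E` over `E* × ℝ → Q`. -/
def contactProlongationData [FiniteDimensional ℝ EQ] [T2Space Q] [FiniteDimensional ℝ F]
    [I.Boundaryless] : BracketData (dualModel I F) (fun p => 𝓔.contactProlongation p) :=
  𝓔.prolongationData (dualModel I F) (contMDiff_dualProj I F E)

/-- The bundle map `(Id_E, Tγ ∘ ρ)` over `γ`, `a ↦ (a, Tγ(ρ(a)))`. -/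
def liftMap (γ₀ : Cₛ^∞⟮I; F →L[ℝ] ℝ, DualFiber E⟯) (γs : C^∞⟮I, Q; ℝ⟯) (q : Q) :
    E q →ₗ[ℝ] 𝓔.contactProlongation (dualSection γ₀ γs q) :=
  LinearMap.codRestrict _
    (LinearMap.prod (LinearMap.id (R := ℝ) (M := E q))
      ((mfderiv I (dualModel I F) (dualSection γ₀ γs) q).toLinearMap ∘ₗ 𝓔.anchor q)) (by
    intro a
    change 𝓔.anchor q a = mfderiv (dualModel I F) I dualProj (dualSection γ₀ γs q)
      (mfderiv I (dualModel I F) (dualSection γ₀ γs) q (𝓔.anchor q a))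
    rw [← mfderiv_comp_apply q (((contMDiff_dualProj I F E) _).mdifferentiableAt (by simp))
      (((contMDiff_dualSection γ₀ γs) q).mdifferentiableAt (by simp))]
    have h : dualProj ∘ dualSection γ₀ γs = (id : Q → Q) := rfl
    rw [h, mfderiv_id]
    rfl)

/-- The Liouville section `Θ_{(b, s)}(a, v) = b(a)`. -/
def liouvilleSection (p : DualR F E) : 𝓔.contactProlongation p →ₗ[ℝ] ℝ :=
  ((p.1.2).toLinearMap ∘ₗ LinearMap.fst ℝ _ _) ∘ₗ (𝓔.contactProlongation p).subtype

/-- The section `𝒱ˢ` dual to `∂/∂s`, that is `(a, v) ↦ ds(v)` where `s : E* × ℝ → ℝ` is the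
projection. -/
def vSection (p : DualR F E) : 𝓔.contactProlongation p →ₗ[ℝ] ℝ :=
  ((mvfderiv (dualModel I F) (Prod.snd : DualR F E → ℝ) p).toLinearMap ∘ₗ LinearMap.snd ℝ _ _) ∘ₗ
    (𝓔.contactProlongation p).subtype

/-- The contact section `η = 𝒱ˢ - Θ`, as a `1`-form on the prolongation. -/
def contactForm (p : DualR F E) : 𝓔.contactProlongation p [⋀^Fin 1]→ₗ[ℝ] ℝ :=
  AlternatingMap.ofSubsingleton ℝ _ ℝ 0 (𝓔.vSection p - 𝓔.liouvilleSection p)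

end LieAlgebroid

end Contact

end Algebroid

end

/-!
A local frame `W` of a Lie algebroid, with dual coframe `θ`, has a covariant derivative
`∇_v Z = ∑ b, v(θ b Z) W b`. Each term of `dμ(Z₀, …, Z_k)` splits into a part that depends only on
the values `Z_i(x)` and a part in the derivatives `∇ Z_i`, and by the Koszul identity the latter
cancel. Hence `dμ(Z₀, …, Z_k)(x)` depends only on the values of the `Z_i` at `x`, so both sides of
the morphism condition can be computed with sections `Z_i` of the prolongation that are related
along `γ` to the given sections `σ_i` of `E`, that is `Z_i ∘ γ = (σ_i, Tγ(ρ(σ_i)))`. Brackets of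
related sections are related, so the two differentials then agree term by term. Related sections
exist near each point of `γ(Q)`: from `π ∘ γ = id` the map `π` is a submersion there, so pairs
`(a, v)` can be corrected smoothly to elements of the prolongation.
-/

noncomputable section

section Koszul

variable {R V : Type*} [CommRing R] [AddCommGroup V] [Module R V]

theorem alternatingMap_cons_sub {k : ℕ} (μ : V [⋀^Fin (k + 1)]→ₗ[R] R) (a b : V) (w : Fin k → V) :
    μ (Fin.cons (a - b) w) = μ (Fin.cons a w) - μ (Fin.cons b w) :=
  congrArg (fun T => T w) (μ.toMultilinearMap.curryLeft.map_sub a b)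

theorem alternatingMap_update_succAbove {k : ℕ} (μ : V [⋀^Fin (k + 1)]→ₗ[R] R)
    (v : Fin (k + 2) → V) (i : Fin (k + 2)) (l : Fin (k + 1)) (d : V) :
    μ (Function.update (fun m => v (i.succAbove m)) l d) =
      (-1) ^ (l : ℕ) * μ (Fin.cons d (l.removeNth (i.removeNth v))) := by
  have h := μ.map_insertNth l d (l.removeNth (i.removeNth v))
  rw [Fin.insertNth_removeNth] at h
  exact h.trans (by simp [Matrix.vecCons])

/-- Each vector `D i j` enters the first sum once, with the sign that the second sum cancels. -/
theorem sum_update_add_sum_cons_eq_zero {k : ℕ} (μ : V [⋀^Fin (k + 1)]→ₗ[R] R)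
    (v : Fin (k + 2) → V) (D : Fin (k + 2) → Fin (k + 2) → V) :
    (∑ i : Fin (k + 2), (-1) ^ (i : ℕ) * ∑ l : Fin (k + 1),
      μ (Function.update (fun m => v (i.succAbove m)) l (D i (i.succAbove l)))) +
    (∑ j : Fin (k + 2), ∑ i : Fin (k + 1), if i.castSucc < j then
      (-1) ^ ((i : ℕ) + (j : ℕ)) * μ (Fin.cons (D i.castSucc j - D j i.castSucc)
        (fun l : Fin k => v (j.succAbove (i.succAbove l)))) else 0) = 0 := by
  simp only [alternatingMap_update_succAbove, Finset.mul_sum]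
  rw [Fin.sum_sum_eq_sum_triangle_add, Fin.sum_univ_succ (n := k + 1)]
  simp only [Fin.not_lt_zero, if_false, Finset.sum_const_zero, zero_add]
  rw [Finset.sum_comm (s := (Finset.univ : Finset (Fin (k + 1))))
    (t := (Finset.univ : Finset (Fin (k + 1)))), ← Finset.sum_add_distrib]
  refine Finset.sum_eq_zero fun i _ => ?_
  have below_eq_Ici : (Finset.univ.filter fun j : Fin (k + 1) => i.castSucc < j.succ) =
      Finset.Ici i := by
    ext j
    simp [Fin.castSucc_lt_succ_iff]
  rw [← Finset.sum_filter, below_eq_Ici, ← Finset.sum_add_distrib]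
  refine Finset.sum_eq_zero fun j hj => ?_
  rw [Finset.mem_Ici] at hj
  have castSucc_succAbove : i.castSucc.succAbove j = j.succ := by
    simp [Fin.succAbove_of_le_castSucc, hj]
  have predAbove_castSucc : j.predAbove i.castSucc = i := by
    simp [Fin.predAbove_of_le_castSucc, hj]
  have succ_succAbove : j.succ.succAbove i = i.castSucc := by
    simp [Fin.succAbove_of_castSucc_lt, hj]
  have removeNth_removeNth : (fun l : Fin k => v (j.succ.succAbove (i.succAbove l))) =
      i.removeNth (j.succ.removeNth v) := rfl
  rw [Fin.removeNth_removeNth_eq_swap, castSucc_succAbove, predAbove_castSucc, succ_succAbove,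
    alternatingMap_cons_sub, removeNth_removeNth]
  simp only [Fin.val_castSucc, Fin.val_succ]
  ring

end Koszul

section Expansion

variable {R V ι : Type*} [CommRing R] [AddCommGroup V] [Module R V] [Fintype ι] {k : ℕ}

theorem alternatingMap_sum_smul (μ : V [⋀^Fin k]→ₗ[R] R) (c : Fin k → ι → R) (W : ι → V) :
    μ (fun l => ∑ a, c l a • W a) = ∑ β : Fin k → ι, (∏ l, c l (β l)) * μ (fun l => W (β l)) := by
  classical
  exact (μ.toMultilinearMap.map_sum fun l a => c l a • W a).trans
    (Finset.sum_congr rfl fun β _ => μ.toMultilinearMap.map_smul_univ _ _)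

theorem alternatingMap_update_sum_smul (μ : V [⋀^Fin k]→ₗ[R] R) (c : Fin k → ι → R) (W : ι → V)
    (l : Fin k) (d : ι → R) :
    μ (Function.update (fun m => ∑ a, c m a • W a) l (∑ a, d a • W a)) =
      ∑ β : Fin k → ι, (∏ m ∈ Finset.univ.erase l, c m (β m)) * d (β l) *
        μ (fun l => W (β l)) := by
  have update_eq : Function.update (fun m => ∑ a, c m a • W a) l (∑ a, d a • W a) =
      fun m => ∑ a, Function.update c l d m a • W a := by
    ext m
    rcases eq_or_ne m l with rfl | h <;> simp [*]
  rw [update_eq, alternatingMap_sum_smul]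
  refine Finset.sum_congr rfl fun β _ => ?_
  rw [← Finset.prod_erase_mul _ _ (Finset.mem_univ l), Function.update_self]
  congr 2
  refine Finset.prod_congr rfl fun m hm => ?_
  rw [Function.update_of_ne (Finset.ne_of_mem_erase hm)]

end Expansion

section ProductRule

variable {EM : Type*} [NormedAddCommGroup EM] [NormedSpace ℝ EM]
  {HM : Type*} [TopologicalSpace HM] {I : ModelWithCorners ℝ EM HM}
  {M : Type*} [TopologicalSpace M] [ChartedSpace HM M] {x : M}

theorem mvfderiv_mul_apply {f g : M → ℝ} (hf : MDifferentiableAt I 𝓘(ℝ, ℝ) f x)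
    (hg : MDifferentiableAt I 𝓘(ℝ, ℝ) g x) (v : TangentSpace I x) :
    mvfderiv I (fun y => f y * g y) x v = f x * mvfderiv I g x v + mvfderiv I f x v * g x :=
  (congrArg (fun T => T v) (mvfderiv_mul hf hg)).trans <| by
    simp only [_root_.add_apply, _root_.smul_apply, smul_eq_mul, mul_comm (g x)]

theorem hasMFDerivAt_finsetProd {κ : Type} [Fintype κ] [DecidableEq κ] {c : κ → M → ℝ}
    (hc : ∀ l, MDifferentiableAt I 𝓘(ℝ, ℝ) (c l) x) :
    HasMFDerivAt I 𝓘(ℝ, ℝ) (fun y => ∏ l, c l y) x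
      (∑ l, (∏ m ∈ Finset.univ.erase l, c m x) • mvfderiv I (c l) x) := by
  have h := HasMFDerivAt.prod (t := Finset.univ) fun l _ => (hc l).hasMFDerivAt
  rwa [show (∏ l, c l) = fun y => ∏ l, c l y from funext fun y => Finset.prod_apply y _ _] at h

variable [IsManifold I ∞ M]

theorem mvfderiv_finsetSum_apply {κ : Type*} (s : Finset κ) {f : κ → M → ℝ}
    (hf : ∀ i, MDifferentiableAt I 𝓘(ℝ, ℝ) (f i) x) (v : TangentSpace I x) :
    mvfderiv I (fun y => ∑ i ∈ s, f i y) x v = ∑ i ∈ s, mvfderiv I (f i) x v := by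
  rw [mvfderiv_finset_sum s f x hf, _root_.sum_apply]

theorem mvfderiv_sum_prod_mul_apply {ι : Type*} [Fintype ι] {k : ℕ} {c : Fin k → ι → M → ℝ}
    {m : (Fin k → ι) → M → ℝ} (hc : ∀ l a, MDifferentiableAt I 𝓘(ℝ, ℝ) (c l a) x)
    (hm : ∀ β, MDifferentiableAt I 𝓘(ℝ, ℝ) (m β) x) (v : TangentSpace I x) :
    mvfderiv I (fun y => ∑ β, (∏ l, c l (β l) y) * m β y) x v =
      ∑ β, (∏ l, c l (β l) x) * mvfderiv I (m β) x v +
        ∑ l, ∑ β : Fin k → ι, (∏ j ∈ Finset.univ.erase l, c j (β j) x) *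
          mvfderiv I (c l (β l)) x v * m β x := by
  classical
  have hprod := fun β : Fin k → ι => hasMFDerivAt_finsetProd fun l => hc l (β l)
  rw [mvfderiv_finsetSum_apply (f := fun β y => (∏ l, c l (β l) y) * m β y) _
      (fun β => (hprod β).mdifferentiableAt.mul (hm β)), Finset.sum_comm, ← Finset.sum_add_distrib]
  refine Finset.sum_congr rfl fun β _ => ?_
  have prod_deriv : mvfderiv I (fun y => ∏ l, c l (β l) y) x v =
      ∑ l, (∏ j ∈ Finset.univ.erase l, c j (β j) x) * mvfderiv I (c l (β l)) x v := by
    have h : mvfderiv I (fun y => ∏ l, c l (β l) y) x =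
        ∑ l, (∏ j ∈ Finset.univ.erase l, c j (β j) x) • mvfderiv I (c l (β l)) x :=
      (hprod β).mfderiv
    simp only [h, _root_.sum_apply, _root_.smul_apply, smul_eq_mul]
  rw [mvfderiv_mul_apply (hprod β).mdifferentiableAt (hm β), prod_deriv, Finset.sum_mul]

end ProductRule

section Tensoriality

variable {EM : Type*} [NormedAddCommGroup EM] [NormedSpace ℝ EM]
  {HM : Type*} [TopologicalSpace HM] {I : ModelWithCorners ℝ EM HM}
  {M : Type*} [TopologicalSpace M] [ChartedSpace HM M]
  {A : M → Type*} [∀ x, AddCommGroup (A x)] [∀ x, Module ℝ (A x)]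

namespace BracketData

/-- A skew-symmetric bracket that satisfies the Leibniz rule. The rule is stated for germs of
combinations `∑ b, g b • W b`, so that it also makes the bracket local. -/
structure IsLeibniz (D : BracketData I A) : Prop where
  skew : ∀ Z Z' x, D.eval (D.bracket Z Z') x = -D.eval (D.bracket Z' Z) x
  leibniz : ∀ {ι : Type} [Fintype ι] (Z Z' : D.Sec) (W : ι → D.Sec) (g : ι → M → ℝ) (x : M),
    (∀ b, ContMDiff I 𝓘(ℝ, ℝ) ∞ (g b)) →
    (∀ᶠ y in 𝓝 x, D.eval Z' y = ∑ b, g b y • D.eval (W b) y) →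
    D.eval (D.bracket Z Z') x = ∑ b, g b x • D.eval (D.bracket Z (W b)) x +
      ∑ b, mvfderiv I (g b) x (D.anchor x (D.eval Z x)) • D.eval (W b) x

variable {ι : Type} [Fintype ι]

/-- Sections `W b` that span the fibres near `x`, with coefficient functions `θ b` on the fibres
that take smooth sections to smooth functions. -/
structure IsLocalFrame (D : BracketData I A) (W : ι → D.Sec) (θ : ι → ∀ y, A y → ℝ) (x : M) :
    Prop where
  contMDiff_coeff : ∀ Z b, ContMDiff I 𝓘(ℝ, ℝ) ∞ (fun y => θ b y (D.eval Z y))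
  sum_smul : ∀ᶠ y in 𝓝 x, ∀ a, ∑ b, θ b y a • D.eval (W b) y = a

/-- The covariant derivative `∇_v Z = ∑ b, v(θ b Z) W b` at `x`, for which a local frame `W` with
coefficient functions `θ` is parallel. -/
def frameDeriv (D : BracketData I A) (W : ι → D.Sec) (θ : ι → ∀ y, A y → ℝ) (Z : D.Sec) (x : M) :
    TangentSpace I x →ₗ[ℝ] A x :=
  ∑ b, (mvfderiv I (fun y => θ b y (D.eval Z y)) x).toLinearMap.smulRight (D.eval (W b) x)

/-- Minus the torsion of the covariant derivative `frameDeriv`: the bilinear extension of the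
brackets of the frame. -/
def frameTorsion (D : BracketData I A) (W : ι → D.Sec) (θ : ι → ∀ y, A y → ℝ) (x : M)
    (a a' : A x) : A x :=
  ∑ b, ∑ c, (θ b x a * θ c x a') • D.eval (D.bracket (W b) (W c)) x

variable {D : BracketData I A} {W : ι → D.Sec} {θ : ι → ∀ y, A y → ℝ} {x : M}

theorem frameDeriv_apply (Z : D.Sec) (v : TangentSpace I x) : D.frameDeriv W θ Z x v =
    ∑ b, mvfderiv I (fun y => θ b y (D.eval Z y)) x v • D.eval (W b) x := by
  simp only [frameDeriv, LinearMap.sum_apply]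
  rfl

namespace IsLocalFrame

theorem eventually_eval_eq (hW : D.IsLocalFrame W θ x) (Z : D.Sec) :
    ∀ᶠ y in 𝓝 x, D.eval Z y = ∑ b, θ b y (D.eval Z y) • D.eval (W b) y :=
  hW.sum_smul.mono fun _ hy => (hy _).symm

theorem mdifferentiableAt_coeff (hW : D.IsLocalFrame W θ x) (Z : D.Sec) (b : ι) :
    MDifferentiableAt I 𝓘(ℝ, ℝ) (fun y => θ b y (D.eval Z y)) x :=
  (hW.contMDiff_coeff Z b).mdifferentiableAt (by simp)

theorem bracket_eq (hW : D.IsLocalFrame W θ x) (hD : D.IsLeibniz) (Z Z' : D.Sec) :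
    D.eval (D.bracket Z Z') x = D.frameTorsion W θ x (D.eval Z x) (D.eval Z' x) +
      (D.frameDeriv W θ Z' x (D.anchor x (D.eval Z x)) -
        D.frameDeriv W θ Z x (D.anchor x (D.eval Z' x))) := by
  have bracket_frame : ∀ c, D.eval (D.bracket Z (W c)) x =
      ∑ b, θ b x (D.eval Z x) • D.eval (D.bracket (W b) (W c)) x -
        D.frameDeriv W θ Z x (D.anchor x (D.eval (W c) x)) := by
    intro c
    rw [hD.skew, hD.leibniz (W c) Z W _ x (hW.contMDiff_coeff Z) (hW.eventually_eval_eq Z),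
      neg_add, ← sub_eq_add_neg, ← Finset.sum_neg_distrib]
    simp only [hD.skew (W c), smul_neg, neg_neg, frameDeriv_apply]
  have frameDeriv_sum : D.frameDeriv W θ Z x (D.anchor x (D.eval Z' x)) =
      ∑ c, θ c x (D.eval Z' x) • D.frameDeriv W θ Z x (D.anchor x (D.eval (W c) x)) := by
    conv_lhs => rw [(hW.eventually_eval_eq Z').self_of_nhds]
    simp only [map_sum, map_smul]
  rw [hD.leibniz Z Z' W _ x (hW.contMDiff_coeff Z') (hW.eventually_eval_eq Z')]
  simp only [bracket_frame, smul_sub, Finset.sum_sub_distrib, Finset.smul_sum, smul_smul,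
    frameTorsion, frameDeriv_sum]
  rw [Finset.sum_comm]
  simp only [mul_comm (θ _ x (D.eval Z x)), frameDeriv_apply]
  abel

variable [IsManifold I ∞ M] {k : ℕ} {μ : ∀ y, A y [⋀^Fin k]→ₗ[ℝ] ℝ}

theorem mvfderiv_apply_eval (hW : D.IsLocalFrame W θ x) (hμ : D.IsSmoothForm μ)
    (Z : Fin k → D.Sec) (v : TangentSpace I x) :
    mvfderiv I (fun y => μ y (fun l => D.eval (Z l) y)) x v =
      ∑ β : Fin k → ι, (∏ l, θ (β l) x (D.eval (Z l) x)) *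
          mvfderiv I (fun y => μ y (fun l => D.eval (W (β l)) y)) x v +
        ∑ l, μ x (Function.update (fun m => D.eval (Z m) x) l (D.frameDeriv W θ (Z l) x v)) := by
  have expansion : (fun y => μ y (fun l => D.eval (Z l) y)) =ᶠ[𝓝 x]
      fun y => ∑ β : Fin k → ι, (∏ l, θ (β l) y (D.eval (Z l) y)) *
        μ y (fun l => D.eval (W (β l)) y) := by
    filter_upwards [hW.sum_smul] with y hy
    exact (congrArg (μ y) (funext fun l => (hy (D.eval (Z l) y)).symm)).trans
      (alternatingMap_sum_smul (μ y) (fun l b => θ b y (D.eval (Z l) y)) fun b => D.eval (W b) y)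
  have eval_eq : (fun m => D.eval (Z m) x) =
      fun m => ∑ b, θ b x (D.eval (Z m) x) • D.eval (W b) x :=
    funext fun m => (hW.eventually_eval_eq (Z m)).self_of_nhds
  rw [mvfderiv_congr expansion, mvfderiv_sum_prod_mul_apply
    (c := fun l b y => θ b y (D.eval (Z l) y)) (m := fun β y => μ y fun l => D.eval (W (β l)) y)
    (fun l b => hW.mdifferentiableAt_coeff (Z l) b)
    (fun β => (hμ _).mdifferentiableAt (by simp))]
  congr 1
  refine Finset.sum_congr rfl fun l _ => ?_
  rw [frameDeriv_apply, eval_eq]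
  exact (alternatingMap_update_sum_smul (μ x) (fun m b => θ b x (D.eval (Z m) x))
    (fun b => D.eval (W b) x) l fun b => mvfderiv I (fun y => θ b y (D.eval (Z l) y)) x v).symm

/-- By the Koszul identity the covariant derivatives of the `Z i` cancel in `dμ`. -/
theorem extDeriv_succ (hW : D.IsLocalFrame W θ x) (hD : D.IsLeibniz)
    {μ : ∀ y, A y [⋀^Fin (k + 1)]→ₗ[ℝ] ℝ} (hμ : D.IsSmoothForm μ) (Z : Fin (k + 2) → D.Sec) :
    D.extDeriv μ Z x =
      (∑ i : Fin (k + 2), (-1 : ℝ) ^ (i : ℕ) * ∑ β : Fin (k + 1) → ι,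
        (∏ l, θ (β l) x (D.eval (Z (i.succAbove l)) x)) *
          mvfderiv I (fun y => μ y (fun l => D.eval (W (β l)) y)) x
            (D.anchor x (D.eval (Z i) x))) +
      ∑ j : Fin (k + 2), ∑ i : Fin (k + 1), if i.castSucc < j then
        (-1 : ℝ) ^ ((i : ℕ) + (j : ℕ)) *
          μ x (Fin.cons (D.frameTorsion W θ x (D.eval (Z i.castSucc) x) (D.eval (Z j) x))
            (fun l : Fin k => D.eval (Z (j.succAbove (i.succAbove l))) x)) else 0 := by
  have deriv_eq := fun (i : Fin (k + 2)) v =>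
    hW.mvfderiv_apply_eval hμ (fun l => Z (i.succAbove l)) v
  have koszul := sum_update_add_sum_cons_eq_zero (μ x) (fun i => D.eval (Z i) x)
    fun i j => D.frameDeriv W θ (Z j) x (D.anchor x (D.eval (Z i) x))
  have cons_add : ∀ (a b : A x) (w : Fin k → A x),
      μ x (Fin.cons (a + b) w) = μ x (Fin.cons a w) + μ x (Fin.cons b w) := fun a b w =>
    (μ x).toMultilinearMap.cons_add w a b
  simp only [extDeriv, bracketTerm, deriv_eq, hW.bracket_eq hD, cons_add,
    mul_add, ite_add_zero, Finset.sum_add_distrib]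
  linear_combination koszul

end IsLocalFrame

theorem extDeriv_congr [IsManifold I ∞ M] (hD : D.IsLeibniz) (hW : D.IsLocalFrame W θ x) {k : ℕ}
    {μ : ∀ y, A y [⋀^Fin k]→ₗ[ℝ] ℝ} (hμ : D.IsSmoothForm μ) {Z Z' : Fin (k + 1) → D.Sec}
    (hZ : ∀ i, D.eval (Z i) x = D.eval (Z' i) x) : D.extDeriv μ Z x = D.extDeriv μ Z' x := by
  cases k with
  | zero =>
    have function_eq : ∀ i : Fin 1, (fun y => μ y fun l => D.eval (Z (i.succAbove l)) y) =
        fun y => μ y fun l => D.eval (Z' (i.succAbove l)) y := fun i =>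
      funext fun y => congrArg (μ y) (Subsingleton.elim _ _)
    simp only [extDeriv, bracketTerm, hZ, function_eq]
  | succ k => simp only [hW.extDeriv_succ hD hμ, hZ]

end BracketData

end Tensoriality

section Morphism

variable {EM : Type*} [NormedAddCommGroup EM] [NormedSpace ℝ EM]
  {HM : Type*} [TopologicalSpace HM] {I : ModelWithCorners ℝ EM HM}
  {M : Type*} [TopologicalSpace M] [ChartedSpace HM M]
  {EN : Type*} [NormedAddCommGroup EN] [NormedSpace ℝ EN]
  {HN : Type*} [TopologicalSpace HN] {J : ModelWithCorners ℝ EN HN}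
  {N : Type*} [TopologicalSpace N] [ChartedSpace HN N]
  {A : M → Type*} [∀ x, AddCommGroup (A x)] [∀ x, Module ℝ (A x)]
  {B : N → Type*} [∀ y, AddCommGroup (B y)] [∀ y, Module ℝ (B y)]
  {D : BracketData I A} {D' : BracketData J B} {f : M → N} {Φ : ∀ x, A x →ₗ[ℝ] B (f x)}

variable (D D' Φ) in
/-- The sections `σ` and `Z` are related near `x` by the bundle map `Φ` over `f`:
`Φ ∘ σ = Z ∘ f`. -/
def IsRelatedAt (σ : D.Sec) (Z : D'.Sec) (x : M) : Prop :=
  ∀ᶠ y in 𝓝 x, D'.eval Z (f y) = Φ y (D.eval σ y)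

theorem eventually_pullbackForm_eq {x : M} {k : ℕ} {σ : Fin k → D.Sec} {Z : Fin k → D'.Sec}
    (hσZ : ∀ l, IsRelatedAt D D' Φ (σ l) (Z l) x) (μ : ∀ y, B y [⋀^Fin k]→ₗ[ℝ] ℝ) :
    (fun y => pullbackForm f Φ μ y fun l => D.eval (σ l) y) =ᶠ[𝓝 x]
      fun y => μ (f y) fun l => D'.eval (Z l) (f y) := by
  filter_upwards [eventually_all.2 hσZ] with y hy
  simp only [pullbackForm, AlternatingMap.compLinearMap_apply, hy]

variable [IsManifold I ∞ M]

theorem extDeriv_pullbackForm_of_isRelatedAt {x : M} (hf : MDifferentiableAt I J f x)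
    (anchor_map : ∀ a, D'.anchor (f x) (Φ x a) = mfderiv I J f x (D.anchor x a)) {k : ℕ}
    {σ : Fin (k + 1) → D.Sec} {Z : Fin (k + 1) → D'.Sec}
    (hσZ : ∀ l, IsRelatedAt D D' Φ (σ l) (Z l) x)
    (bracket_map : ∀ i j, D'.eval (D'.bracket (Z i) (Z j)) (f x) =
      Φ x (D.eval (D.bracket (σ i) (σ j)) x))
    {μ : ∀ y, B y [⋀^Fin k]→ₗ[ℝ] ℝ} (hμ : D'.IsSmoothForm μ) :
    D.extDeriv (pullbackForm f Φ μ) σ x = D'.extDeriv μ Z (f x) := by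
  have eval_eq : ∀ l, D'.eval (Z l) (f x) = Φ x (D.eval (σ l) x) := fun l => (hσZ l).self_of_nhds
  have deriv_eq : ∀ i : Fin (k + 1),
      mvfderiv I (fun y => pullbackForm f Φ μ y fun l => D.eval (σ (i.succAbove l)) y) x
        (D.anchor x (D.eval (σ i) x)) =
      mvfderiv J (fun y => μ y fun l => D'.eval (Z (i.succAbove l)) y) (f x)
        (D'.anchor (f x) (D'.eval (Z i) (f x))) := fun i => by
    rw [mvfderiv_congr (eventually_pullbackForm_eq (fun l => hσZ (i.succAbove l)) μ), eval_eq,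
      anchor_map]
    exact mvfderiv_comp_apply x ((hμ fun l => Z (i.succAbove l)).mdifferentiableAt (by simp)) hf _
  unfold BracketData.extDeriv
  simp only [deriv_eq]
  congr 1
  cases k with
  | zero => rfl
  | succ k =>
    have cons_map : ∀ (a : A x) (w : Fin k → A x), pullbackForm f Φ μ x (Fin.cons a w) =
        μ (f x) (Fin.cons (Φ x a) fun l => Φ x (w l)) := fun a w =>
      congrArg (μ (f x)) (Fin.comp_cons (Φ x) a w)
    simp only [BracketData.bracketTerm, bracket_map, eval_eq, cons_map]

variable [IsManifold J ∞ N]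

theorem isLieAlgebroidMorphism_of_isRelatedAt (hf : ContMDiff I J ∞ f) (hD' : D'.IsLeibniz)
    (exists_frame : ∀ x, ∃ (ι : Type) (_ : Fintype ι) (W : ι → D'.Sec) (θ : ι → ∀ y, B y → ℝ),
      D'.IsLocalFrame W θ (f x))
    (anchor_map : ∀ x a, D'.anchor (f x) (Φ x a) = mfderiv I J f x (D.anchor x a))
    (exists_related : ∀ x σ, ∃ Z, IsRelatedAt D D' Φ σ Z x)
    (bracket_map : ∀ {x σ τ Z Y}, IsRelatedAt D D' Φ σ Z x → IsRelatedAt D D' Φ τ Y x →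
      D'.eval (D'.bracket Z Y) (f x) = Φ x (D.eval (D.bracket σ τ) x)) :
    IsLieAlgebroidMorphism D D' f Φ where
  contMDiff_base := hf
  smooth_pullback μ hμ σ x := by
    choose Z hZ using fun l => exists_related x (σ l)
    exact (((hμ Z).comp hf) x).congr_of_eventuallyEq (eventually_pullbackForm_eq hZ μ)
  extDeriv_pullback μ hμ x σ Z hσZ := by
    obtain ⟨ι, _, W, θ, hW⟩ := exists_frame x
    choose Y hY using fun l => exists_related x (σ l)
    calc D.extDeriv (pullbackForm f Φ μ) σ x
        = D'.extDeriv μ Y (f x) :=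
          extDeriv_pullbackForm_of_isRelatedAt (hf.mdifferentiableAt (by simp)) (anchor_map x) hY
            (fun i j => bracket_map (hY i) (hY j)) hμ
      _ = D'.extDeriv μ Z (f x) :=
          BracketData.extDeriv_congr hD' hW hμ fun i => (hY i).self_of_nhds.trans (hσZ i).symm

end Morphism

section VectorFields

variable {EM : Type*} [NormedAddCommGroup EM] [NormedSpace ℝ EM] [FiniteDimensional ℝ EM]
  {HM : Type*} [TopologicalSpace HM] {I : ModelWithCorners ℝ EM HM} [I.Boundaryless]
  {M : Type*} [TopologicalSpace M] [ChartedSpace HM M] [IsManifold I ∞ M]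
  {V W : ∀ z : M, TangentSpace I z}

theorem mvfderiv_mlieBracket_of_contMDiff {h : M → ℝ} (hh : ContMDiff I 𝓘(ℝ, ℝ) ∞ h)
    (hV : ContMDiff I I.tangent ∞ (fun y => (⟨y, V y⟩ : TangentBundle I M)))
    (hW : ContMDiff I I.tangent ∞ (fun y => (⟨y, W y⟩ : TangentBundle I M))) (x : M) :
    mvfderiv I h x (mlieBracket I V W x) =
      mvfderiv I (fun y => mvfderiv I h y (W y)) x (V x) -
        mvfderiv I (fun y => mvfderiv I h y (V y)) x (W x) :=
  have := FiniteDimensional.complete ℝ EM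
  mvfderiv_mlieBracket x h hh V W hV hW
    ((contMDiff_mvfderiv_apply h hh V hV).mdifferentiableAt (by simp))
    ((contMDiff_mvfderiv_apply h hh W hW).mdifferentiableAt (by simp))

theorem mlieBracket_eq_sum_of_eventually [T2Space M] {ι : Type*} [Fintype ι]
    {U : ι → ∀ z : M, TangentSpace I z} {g : ι → M → ℝ} {x : M}
    (hV : ContMDiff I I.tangent ∞ (fun y => (⟨y, V y⟩ : TangentBundle I M)))
    (hW : ContMDiff I I.tangent ∞ (fun y => (⟨y, W y⟩ : TangentBundle I M)))
    (hU : ∀ b, ContMDiff I I.tangent ∞ (fun y => (⟨y, U b y⟩ : TangentBundle I M)))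
    (hg : ∀ b, MDifferentiableAt I 𝓘(ℝ, ℝ) (g b) x)
    (hWU : ∀ᶠ y in 𝓝 x, W y = ∑ b, g b y • U b y) :
    mlieBracket I V W x =
      ∑ b, g b x • mlieBracket I V (U b) x + ∑ b, mvfderiv I (g b) x (V x) • U b x := by
  refine tangent_ext _ _ fun h hh => ?_
  have deriv_W : (fun y => mvfderiv I h y (W y)) =ᶠ[𝓝 x]
      fun y => ∑ b, g b y * mvfderiv I h y (U b y) := by
    filter_upwards [hWU] with y hy
    simp only [hy, map_sum, map_smul, smul_eq_mul]
  have hdU : ∀ b, MDifferentiableAt I 𝓘(ℝ, ℝ) (fun y => mvfderiv I h y (U b y)) x := fun b =>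
    (contMDiff_mvfderiv_apply h hh _ (hU b)).mdifferentiableAt (by simp)
  rw [mvfderiv_mlieBracket_of_contMDiff hh hV hW, mvfderiv_congr deriv_W,
    mvfderiv_finsetSum_apply (f := fun b y => g b y * mvfderiv I h y (U b y)) _
      fun b => (hg b).mul (hdU b), hWU.self_of_nhds]
  simp only [mvfderiv_mul_apply (hg _) (hdU _), map_add, map_sum, map_smul, smul_eq_mul,
    mvfderiv_mlieBracket_of_contMDiff hh hV (hU _), mul_sub, Finset.sum_add_distrib,
    Finset.sum_sub_distrib]
  ring

variable {EN : Type*} [NormedAddCommGroup EN] [NormedSpace ℝ EN] [FiniteDimensional ℝ EN]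
  {HN : Type*} [TopologicalSpace HN] {J : ModelWithCorners ℝ EN HN} [J.Boundaryless]
  {N : Type*} [TopologicalSpace N] [ChartedSpace HN N] [IsManifold J ∞ N] [T2Space N]
  {V' W' : ∀ z : N, TangentSpace J z} {f : M → N} {x : M}

theorem mfderiv_mlieBracket_of_related (hf : ContMDiff I J ∞ f)
    (hV : ContMDiff I I.tangent ∞ (fun y => (⟨y, V y⟩ : TangentBundle I M)))
    (hW : ContMDiff I I.tangent ∞ (fun y => (⟨y, W y⟩ : TangentBundle I M)))
    (hV' : ContMDiff J J.tangent ∞ (fun z => (⟨z, V' z⟩ : TangentBundle J N)))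
    (hW' : ContMDiff J J.tangent ∞ (fun z => (⟨z, W' z⟩ : TangentBundle J N)))
    (hVV' : ∀ᶠ y in 𝓝 x, V' (f y) = mfderiv I J f y (V y))
    (hWW' : ∀ᶠ y in 𝓝 x, W' (f y) = mfderiv I J f y (W y)) :
    mlieBracket J V' W' (f x) = mfderiv I J f x (mlieBracket I V W x) := by
  have hdf : ∀ y, MDifferentiableAt I J f y := fun y => (hf y).mdifferentiableAt (by simp)
  refine tangent_ext _ _ fun h hh => ?_
  have hdh : ∀ z, MDifferentiableAt J 𝓘(ℝ, ℝ) h z := fun z => (hh z).mdifferentiableAt (by simp)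
  have deriv_comp : ∀ {X : ∀ y : M, TangentSpace I y} {X' : ∀ z : N, TangentSpace J z},
      (∀ᶠ y in 𝓝 x, X' (f y) = mfderiv I J f y (X y)) →
      (fun y => mvfderiv I (h ∘ f) y (X y)) =ᶠ[𝓝 x] (fun z => mvfderiv J h z (X' z)) ∘ f := by
    intro X X' hX
    filter_upwards [hX] with y hy
    rw [mvfderiv_comp_apply y (hdh _) (hdf y), Function.comp_apply, hy]
  have hd : ∀ {X' : ∀ z : N, TangentSpace J z},
      ContMDiff J J.tangent ∞ (fun z => (⟨z, X' z⟩ : TangentBundle J N)) →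
      MDifferentiableAt J 𝓘(ℝ, ℝ) (fun z => mvfderiv J h z (X' z)) (f x) := fun hX' =>
    (contMDiff_mvfderiv_apply h hh _ hX').mdifferentiableAt (by simp)
  rw [← mvfderiv_comp_apply x (hdh _) (hdf x), mvfderiv_mlieBracket_of_contMDiff hh hV' hW',
    mvfderiv_mlieBracket_of_contMDiff (hh.comp hf) hV hW, mvfderiv_congr (deriv_comp hVV'),
    mvfderiv_congr (deriv_comp hWW'), mvfderiv_comp_apply x (hd hV') (hdf x),
    mvfderiv_comp_apply x (hd hW') (hdf x), hVV'.self_of_nhds, hWW'.self_of_nhds]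

end VectorFields

section Matrices

variable {EM : Type*} [NormedAddCommGroup EM] [NormedSpace ℝ EM]
  {HM : Type*} [TopologicalSpace HM] {I : ModelWithCorners ℝ EM HM}
  {M : Type*} [TopologicalSpace M] [ChartedSpace HM M]
  {n : Type*} [Fintype n] [DecidableEq n] {B : M → Matrix n n ℝ}

theorem contMDiff_matrixDet (hB : ∀ i j, ContMDiff I 𝓘(ℝ, ℝ) ∞ fun x => B x i j) :
    ContMDiff I 𝓘(ℝ, ℝ) ∞ fun x => (B x).det := by
  simp only [Matrix.det_apply']
  exact contMDiff_finsetSum fun σ _ =>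
    contMDiff_const.mul (contMDiff_finsetProd fun i _ => hB (σ i) i)

theorem contMDiff_matrixAdjugate (hB : ∀ i j, ContMDiff I 𝓘(ℝ, ℝ) ∞ fun x => B x i j) (i j : n) :
    ContMDiff I 𝓘(ℝ, ℝ) ∞ fun x => (B x).adjugate i j := by
  simp only [Matrix.adjugate_apply]
  refine contMDiff_matrixDet fun k l => ?_
  by_cases hk : k = j
  · simpa only [hk, Matrix.updateRow_self] using contMDiff_const
  · simpa only [Matrix.updateRow_ne hk] using hB k l

variable [FiniteDimensional ℝ EM] [IsManifold I ∞ M] [T2Space M]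

theorem exists_contMDiff_eventually_mul_eq_one {h : M → ℝ} (hh : ContMDiff I 𝓘(ℝ, ℝ) ∞ h) {x : M}
    (hx : h x ≠ 0) : ∃ g : M → ℝ, ContMDiff I 𝓘(ℝ, ℝ) ∞ g ∧ ∀ᶠ y in 𝓝 x, h y * g y = 1 := by
  obtain ⟨ψ, -, hψ⟩ := (SmoothBumpFunction.nhds_basis_tsupport (I := I) x).mem_iff.1
    (hh.continuous.continuousAt.eventually_ne hx)
  refine ⟨fun y => ψ y * (h y)⁻¹, contMDiff_of_tsupport fun y hy => ?_, ?_⟩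
  · exact ψ.contMDiff.contMDiffAt.mul
      (hh.contMDiffAt.inv₀ (hψ (closure_mono (Function.support_mul_subset_left _ _) hy)))
  · filter_upwards [ψ.eventuallyEq_one, hh.continuous.continuousAt.eventually_ne hx] with y hy hy'
    simp only [hy, Pi.one_apply, one_mul, mul_inv_cancel₀ hy']

theorem exists_contMDiff_matrix_eventually_mul_eq_one
    (hB : ∀ i j, ContMDiff I 𝓘(ℝ, ℝ) ∞ fun x => B x i j) {x : M} (hx : (B x).det ≠ 0) :
    ∃ C : M → Matrix n n ℝ, (∀ i j, ContMDiff I 𝓘(ℝ, ℝ) ∞ fun y => C y i j) ∧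
      ∀ᶠ y in 𝓝 x, B y * C y = 1 := by
  obtain ⟨g, hg, hBg⟩ := exists_contMDiff_eventually_mul_eq_one (contMDiff_matrixDet hB) hx
  refine ⟨fun y => g y • (B y).adjugate,
    fun i j => hg.mul (contMDiff_matrixAdjugate hB i j), hBg.mono fun y hy => ?_⟩
  rw [Matrix.mul_smul, Matrix.mul_adjugate, smul_smul, mul_comm, hy, one_smul]

end Matrices

section Frames

variable {EQ : Type*} [NormedAddCommGroup EQ] [NormedSpace ℝ EQ] [FiniteDimensional ℝ EQ]
  {HQ : Type*} [TopologicalSpace HQ] {I : ModelWithCorners ℝ EQ HQ}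
  {Q : Type*} [TopologicalSpace Q] [ChartedSpace HQ Q] [IsManifold I ∞ Q] [T2Space Q]
  {F : Type*} [NormedAddCommGroup F] [NormedSpace ℝ F] [FiniteDimensional ℝ F]
  {E : Q → Type*} [∀ q, AddCommGroup (E q)] [∀ q, Module ℝ (E q)]
  [TopologicalSpace (TotalSpace F E)] [∀ q, TopologicalSpace (E q)]
  [FiberBundle F E] [VectorBundle ℝ F E] [ContMDiffVectorBundle ∞ F E I]

variable (I F E) in
/-- The restriction of `coframe I F E q₀ i` to the fibre over `q`, as a linear form. -/
def coframeAt (q₀ : Q) (i : Fin (finrank ℝ F)) (q : Q) : E q →ₗ[ℝ] ℝ :=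
  bump I F E q₀ q • (finBasis ℝ F).coord i ∘ₗ (trivializationAt F E q₀).linearMapAt ℝ q

theorem coframe_eq_coframeAt (q₀ : Q) (i : Fin (finrank ℝ F)) {q : Q} (a : E q) :
    coframe I F E q₀ i ⟨q, a⟩ = coframeAt I F E q₀ i q a := by
  by_cases hq : q ∈ (trivializationAt F E q₀).baseSet
  · simp only [coframe, coframeAt, LinearMap.smul_apply, LinearMap.comp_apply, Basis.coord_apply,
      (trivializationAt F E q₀).coe_linearMapAt_of_mem hq, smul_eq_mul]
  · have bump_eq : bump I F E q₀ q = 0 :=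
      image_eq_zero_of_notMem_tsupport fun h => hq (tsupport_bump I F E q₀ h)
    simp only [coframe, coframeAt, bump_eq, zero_mul, zero_smul, LinearMap.zero_apply]

theorem eventually_bump_comp_eq_one {X : Type*} [TopologicalSpace X] {f : X → Q} {x : X}
    (hf : ContinuousAt f x) : ∀ᶠ y in 𝓝 x, bump I F E (f x) (f y) = 1 :=
  hf.eventually (bump I F E (f x)).eventuallyEq_one

theorem contMDiff_coframeAt {EP : Type*} [NormedAddCommGroup EP] [NormedSpace ℝ EP]
    {HP : Type*} [TopologicalSpace HP] {IP : ModelWithCorners ℝ EP HP}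
    {P : Type*} [TopologicalSpace P] [ChartedSpace HP P] {f : P → Q} {s : ∀ p, E (f p)}
    (hs : ContMDiff IP (I.prod 𝓘(ℝ, F)) ∞ fun p => (⟨f p, s p⟩ : TotalSpace F E)) (q₀ : Q)
    (i : Fin (finrank ℝ F)) : ContMDiff IP 𝓘(ℝ, ℝ) ∞ fun p => coframeAt I F E q₀ i (f p) (s p) := by
  simpa only [Function.comp_def, coframe_eq_coframeAt] using (contMDiff_coframe I F E q₀ i).comp hs

theorem sum_coframeAt_smul_frame {q₀ q : Q} (hq : bump I F E q₀ q = 1) (a : E q) :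
    ∑ i, coframeAt I F E q₀ i q a • frame I F E q₀ i q = a := by
  simp only [← coframe_eq_coframeAt, sum_coframe_smul_frame q₀ q hq a]

theorem coframeAt_frame {q₀ q : Q} (hq : bump I F E q₀ q = 1) (i j : Fin (finrank ℝ F)) :
    coframeAt I F E q₀ i q (frame I F E q₀ j q) = if i = j then 1 else 0 := by
  have hq' : q ∈ (trivializationAt F E q₀).baseSet :=
    tsupport_bump I F E q₀ (subset_tsupport _ (by simp [hq]))
  have frame_eq : frame I F E q₀ j q =
      ((trivializationAt F E q₀).linearEquivAt ℝ q hq').symm (finBasis ℝ F j) := by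
    change bump I F E q₀ q • (trivializationAt F E q₀).localFrame (finBasis ℝ F) j q = _
    rw [hq, one_smul, (trivializationAt F E q₀).localFrame_apply_of_mem_baseSet _ hq']
    exact Basis.map_apply _ _ _
  have coframe_eq : ∀ a, coframeAt I F E q₀ i q a =
      (finBasis ℝ F).coord i ((trivializationAt F E q₀).linearEquivAt ℝ q hq' a) := fun a => by
    simp [coframeAt, hq, (trivializationAt F E q₀).linearMapAt_def_of_mem hq']
  rw [coframe_eq, frame_eq, LinearEquiv.apply_symm_apply, Basis.coord_apply, Basis.repr_self,
    Finsupp.single_apply]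
  simp only [eq_comm]

theorem exists_section_apply_eq (q : Q) (a : E q) : ∃ σ : Cₛ^∞⟮I; F, E⟯, σ q = a := by
  refine ⟨∑ i, coframeAt I F E q i q a • frame I F E q i, ?_⟩
  rw [LieAlgebroid.sum_section_apply]
  exact sum_coframeAt_smul_frame (bump I F E q).eq_one a

end Frames

section Submersions

variable {EQ : Type*} [NormedAddCommGroup EQ] [NormedSpace ℝ EQ] [FiniteDimensional ℝ EQ]
  {HQ : Type*} [TopologicalSpace HQ] {I : ModelWithCorners ℝ EQ HQ}
  {Q : Type*} [TopologicalSpace Q] [ChartedSpace HQ Q] [IsManifold I ∞ Q] [T2Space Q]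
  {EP : Type*} [NormedAddCommGroup EP] [NormedSpace ℝ EP] [FiniteDimensional ℝ EP]
  {HP : Type*} [TopologicalSpace HP] {IP : ModelWithCorners ℝ EP HP}
  {P : Type*} [TopologicalSpace P] [ChartedSpace HP P] [IsManifold IP ∞ P] [T2Space P]
  {pr : P → Q}

/-- A family of lifts at `p` is corrected by the inverse of the matrix of its image in the
frame. -/
theorem exists_lift_frame (hpr : ContMDiff IP I ∞ pr) {p : P}
    (hp : Function.Surjective (mfderiv IP I pr p)) :
    ∃ L : Fin (finrank ℝ EQ) → Cₛ^∞⟮IP; EP, (TangentSpace IP : P → Type _)⟯,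
      ∀ᶠ y in 𝓝 p, ∀ j, mfderiv IP I pr y (L j y) =
        frame I EQ (TangentSpace I : Q → Type _) (pr p) j (pr y) := by
  let u := frame I EQ (TangentSpace I : Q → Type _) (pr p)
  let θ := coframeAt I EQ (TangentSpace I : Q → Type _) (pr p)
  choose w hw using fun j => hp (u j (pr p))
  choose K hK using fun j =>
    exists_section_apply_eq (I := IP) (F := EP) (E := (TangentSpace IP : P → Type _)) p (w j)
  let B : P → Matrix (Fin (finrank ℝ EQ)) (Fin (finrank ℝ EQ)) ℝ :=
    fun y => .of fun i j => θ i (pr y) (mfderiv IP I pr y (K j y))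
  have B_smooth : ∀ i j, ContMDiff IP 𝓘(ℝ, ℝ) ∞ fun y => B y i j := fun i j =>
    contMDiff_coframeAt ((hpr.contMDiff_tangentMap (m := ∞) le_rfl).comp (K j).contMDiff) _ i
  have B_one : B p = 1 := by
    ext i j
    simp only [B, Matrix.of_apply, hK, hw, Matrix.one_apply]
    exact coframeAt_frame (bump I EQ (TangentSpace I : Q → Type _) (pr p)).eq_one i j
  obtain ⟨C, hC, hBC⟩ := exists_contMDiff_matrix_eventually_mul_eq_one B_smooth (x := p)
    (by simp [B_one])
  refine ⟨fun j => ∑ i, smulSection ⟨fun y => C y i j, hC i j⟩ (K i), ?_⟩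
  filter_upwards [hBC, eventually_bump_comp_eq_one (I := I) (F := EQ)
    (E := (TangentSpace I : Q → Type _)) hpr.continuous.continuousAt] with y hy hy' j
  calc mfderiv IP I pr y ((∑ i, smulSection ⟨fun y => C y i j, hC i j⟩ (K i) :
        Cₛ^∞⟮IP; EP, (TangentSpace IP : P → Type _)⟯) y)
      = ∑ i, C y i j • mfderiv IP I pr y (K i y) := by
        rw [LieAlgebroid.sum_section_apply, map_sum]
        exact Finset.sum_congr rfl fun i _ => map_smul _ _ _
    _ = ∑ i, C y i j • ∑ k, B y k i • u k (pr y) := by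
        simp only [B, Matrix.of_apply, θ, u, sum_coframeAt_smul_frame hy']
    _ = ∑ k, (B y * C y) k j • u k (pr y) := by
        simp only [Finset.smul_sum, Matrix.mul_apply, Finset.sum_smul, smul_smul]
        rw [Finset.sum_comm]
        simp only [mul_comm]
    _ = u j (pr y) := by simp [hy, Matrix.one_apply]

theorem exists_local_rightInverse_mfderiv (hpr : ContMDiff IP I ∞ pr) {p : P}
    (hp : Function.Surjective (mfderiv IP I pr p)) :
    ∃ S : ∀ y, TangentSpace I (pr y) →ₗ[ℝ] TangentSpace IP y,
      (∀ᶠ y in 𝓝 p, ∀ v, mfderiv IP I pr y (S y v) = v) ∧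
      ∀ {Y : ∀ y, TangentSpace I (pr y)},
        ContMDiff IP I.tangent ∞ (fun y => (⟨pr y, Y y⟩ : TangentBundle I Q)) →
        ContMDiff IP IP.tangent ∞ (fun y => (⟨y, S y (Y y)⟩ : TangentBundle IP P)) := by
  obtain ⟨L, hL⟩ := exists_lift_frame hpr hp
  let θ := coframeAt I EQ (TangentSpace I : Q → Type _) (pr p)
  refine ⟨fun y => ∑ j, (θ j (pr y)).smulRight (L j y), ?_, fun {Y} hY => ?_⟩
  · filter_upwards [hL, eventually_bump_comp_eq_one (I := I) (F := EQ)
      (E := (TangentSpace I : Q → Type _)) hpr.continuous.continuousAt] with y hy hy' v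
    rw [LinearMap.sum_apply, map_sum]
    simp only [LinearMap.smulRight_apply, map_smul, hy]
    exact sum_coframeAt_smul_frame hy' v
  · have smooth_sum := (∑ j, smulSection ⟨_, contMDiff_coframeAt hY (pr p) j⟩ (L j)).contMDiff
    refine smooth_sum.congr fun y => ?_
    rw [LieAlgebroid.sum_section_apply, LinearMap.sum_apply]
    rfl

end Submersions

section AlgebroidData

variable {EQ : Type*} [NormedAddCommGroup EQ] [NormedSpace ℝ EQ] [FiniteDimensional ℝ EQ]
  {HQ : Type*} [TopologicalSpace HQ] {I : ModelWithCorners ℝ EQ HQ}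
  {Q : Type*} [TopologicalSpace Q] [ChartedSpace HQ Q] [IsManifold I ∞ Q] [T2Space Q]
  {F : Type*} [NormedAddCommGroup F] [NormedSpace ℝ F]
  {E : Q → Type*} [∀ q, AddCommGroup (E q)] [∀ q, Module ℝ (E q)]
  [TopologicalSpace (TotalSpace F E)] [∀ q, TopologicalSpace (E q)]
  [FiberBundle F E] [VectorBundle ℝ F E]

namespace LieAlgebroid

variable (𝓔 : LieAlgebroid I F E)

theorem anchor_bracket [I.Boundaryless] (σ τ : Cₛ^∞⟮I; F, E⟯) (q : Q) :
    𝓔.anchor q (𝓔.bracket σ τ q) =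
      mlieBracket I (fun q => 𝓔.anchor q (σ q)) (fun q => 𝓔.anchor q (τ q)) q := by
  refine tangent_ext _ _ fun h hh => ?_
  rw [mvfderiv_mlieBracket_of_contMDiff hh (𝓔.contMDiff_anchor_section σ)
    (𝓔.contMDiff_anchor_section τ)]
  exact 𝓔.anchorDeriv_bracket σ τ ⟨h, hh⟩ q

theorem isLeibniz_data : 𝓔.data.IsLeibniz where
  skew σ τ x := congrArg (fun υ : Cₛ^∞⟮I; F, E⟯ => υ x) (𝓔.bracket_skew σ τ)
  leibniz {ι} _ (σ τ : Cₛ^∞⟮I; F, E⟯) (W : ι → Cₛ^∞⟮I; F, E⟯) g x hg hτ := by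
    let G : ι → C^∞⟮I, Q; ℝ⟯ := fun b => ⟨g b, hg b⟩
    have bracket_eq : 𝓔.bracket σ τ x = 𝓔.bracket σ (∑ b, smulSection (G b) (W b)) x :=
      𝓔.bracket_congr_right σ τ _ x <| hτ.mono fun y hy =>
        hy.trans (sum_section_apply _ (fun b => smulSection (G b) (W b)) y).symm
    refine bracket_eq.trans ?_
    rw [𝓔.bracket_sum_right, sum_section_apply, ← Finset.sum_add_distrib]
    exact Finset.sum_congr rfl fun b _ => 𝓔.leibniz σ (W b) (G b) x

theorem isLocalFrame_data [FiniteDimensional ℝ F] [ContMDiffVectorBundle ∞ F E I] (q₀ : Q) :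
    𝓔.data.IsLocalFrame (frame I F E q₀) (fun i q a => coframeAt I F E q₀ i q a) q₀ where
  contMDiff_coeff σ i := contMDiff_coframeAt (f := id) (ContMDiffSection.contMDiff σ) q₀ i
  sum_smul := (bump I F E q₀).eventuallyEq_one.mono fun _ hq a => sum_coframeAt_smul_frame hq a

end LieAlgebroid

end AlgebroidData

section Prolongation

variable {EQ : Type*} [NormedAddCommGroup EQ] [NormedSpace ℝ EQ] [FiniteDimensional ℝ EQ]
  {HQ : Type*} [TopologicalSpace HQ] {I : ModelWithCorners ℝ EQ HQ}
  {Q : Type*} [TopologicalSpace Q] [ChartedSpace HQ Q] [IsManifold I ∞ Q] [T2Space Q]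
  {F : Type*} [NormedAddCommGroup F] [NormedSpace ℝ F] [FiniteDimensional ℝ F]
  {E : Q → Type*} [∀ q, AddCommGroup (E q)] [∀ q, Module ℝ (E q)]
  [TopologicalSpace (TotalSpace F E)] [∀ q, TopologicalSpace (E q)]
  [FiberBundle F E] [VectorBundle ℝ F E] [ContMDiffVectorBundle ∞ F E I]
  {EP : Type*} [NormedAddCommGroup EP] [NormedSpace ℝ EP]
  {HP : Type*} [TopologicalSpace HP] {IP : ModelWithCorners ℝ EP HP}
  {P : Type*} [TopologicalSpace P] [ChartedSpace HP P] [IsManifold IP ∞ P]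
  {pr : P → Q} {𝓔 : LieAlgebroid I F E}

namespace LieAlgebroid

namespace ProlongationSection

theorem bracketFst_skew (Z Z' : 𝓔.ProlongationSection IP pr) (q₀ : Q) (p : P) :
    bracketFst Z Z' q₀ p = -bracketFst Z' Z q₀ p := by
  have torsion_skew : ∑ i, ∑ j, (Z.coeff q₀ i p * Z'.coeff q₀ j p) •
      𝓔.bracket (frame I F E q₀ i) (frame I F E q₀ j) (pr p) =
      -∑ i, ∑ j, (Z'.coeff q₀ i p * Z.coeff q₀ j p) •
        𝓔.bracket (frame I F E q₀ i) (frame I F E q₀ j) (pr p) := by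
    rw [Finset.sum_comm]
    simp only [← Finset.sum_neg_distrib]
    refine Finset.sum_congr rfl fun j _ => Finset.sum_congr rfl fun i _ => ?_
    rw [𝓔.bracket_skew, ContMDiffSection.coe_neg, Pi.neg_apply, smul_neg, mul_comm]
  rw [bracketFst, bracketFst, torsion_skew]
  abel

theorem eventually_coeff_eq_sum {ι : Type*} [Fintype ι] {Z : 𝓔.ProlongationSection IP pr}
    {W : ι → 𝓔.ProlongationSection IP pr} {g : ι → P → ℝ} {p : P}
    (hZ : ∀ᶠ y in 𝓝 p, Z.fst y = ∑ b, g b y • (W b).fst y) (q₀ : Q) (i : Fin (finrank ℝ F)) :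
    Z.coeff q₀ i =ᶠ[𝓝 p] fun y => ∑ b, g b y * (W b).coeff q₀ i y := by
  filter_upwards [hZ] with y hy
  simp only [coeff, coframe_eq_coframeAt, hy, map_sum, map_smul, smul_eq_mul]

theorem bracketFst_eq_sum {ι : Type*} [Fintype ι]
    (Z Z' : 𝓔.ProlongationSection IP pr)
    {W : ι → 𝓔.ProlongationSection IP pr} {g : ι → P → ℝ} {p : P}
    (hg : ∀ b, MDifferentiableAt IP 𝓘(ℝ, ℝ) (g b) p)
    (hZ' : ∀ᶠ y in 𝓝 p, Z'.fst y = ∑ b, g b y • (W b).fst y)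
    (hX : Z'.vec p = ∑ b, g b p • (W b).vec p) :
    bracketFst Z Z' (pr p) p = ∑ b, g b p • bracketFst Z (W b) (pr p) p +
      ∑ b, mvfderiv IP (g b) p (Z.vec p) • (W b).fst p := by
  have coeff_eq := eventually_coeff_eq_sum hZ' (pr p)
  have hc : ∀ (Y : 𝓔.ProlongationSection IP pr) i, MDifferentiableAt IP 𝓘(ℝ, ℝ)
      (Y.coeff (pr p) i) p := fun Y i => (Y.contMDiff_coeff (pr p) i).mdifferentiableAt (by simp)
  have deriv_coeff : ∀ i, mvfderiv IP (Z'.coeff (pr p) i) p (Z.vec p) =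
      ∑ b, (g b p * mvfderiv IP ((W b).coeff (pr p) i) p (Z.vec p) +
        mvfderiv IP (g b) p (Z.vec p) * (W b).coeff (pr p) i p) := fun i => by
    rw [mvfderiv_congr (coeff_eq i), mvfderiv_finsetSum_apply
      (f := fun b y => g b y * (W b).coeff (pr p) i y) _ fun b => (hg b).mul (hc (W b) i)]
    refine Finset.sum_congr rfl fun b _ => ?_
    rw [mvfderiv_mul_apply (hg b) (hc (W b) i)]
  have fst_eq_sum := fun b => (W b).fst_eq (pr p) p (bump I F E (pr p)).eq_one
  simp only [fst_eq_sum, bracketFst, deriv_coeff, fun i => (coeff_eq i).self_of_nhds, hX]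
  simp only [map_sum, map_smul, smul_eq_mul, Finset.mul_sum, Finset.sum_smul, Finset.smul_sum,
    add_smul, smul_add, smul_sub, smul_smul, Finset.sum_add_distrib, Finset.sum_sub_distrib,
    mul_left_comm (Z.coeff _ _ _)]
  have swap := fun f : Fin (finrank ℝ F) → ι → E (pr p) =>
    Finset.sum_comm (s := Finset.univ) (t := Finset.univ) (f := f)
  rw [Finset.sum_comm_cycle, swap, swap, swap]
  abel

end ProlongationSection

theorem isLeibniz_prolongationData [I.Boundaryless] [FiniteDimensional ℝ EP] [IP.Boundaryless]
    [T2Space P] (hpr : ContMDiff IP I ∞ pr) : (𝓔.prolongationData IP hpr).IsLeibniz where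
  skew (Z Z' : 𝓔.ProlongationSection IP pr) x :=
    Subtype.ext <| Prod.ext (Z.bracketFst_skew Z' (pr x) x) mlieBracket_swap_apply
  leibniz {ι} _ (Z Z' : 𝓔.ProlongationSection IP pr) (W : ι → 𝓔.ProlongationSection IP pr)
      g x hg hZ' := by
    have hgx : ∀ b, MDifferentiableAt IP 𝓘(ℝ, ℝ) (g b) x := fun b =>
      (hg b).mdifferentiableAt (by simp)
    have components : ∀ᶠ y in 𝓝 x, Z'.fst y = ∑ b, g b y • (W b).fst y ∧
        Z'.vec y = ∑ b, g b y • (W b).vec y := hZ'.mono fun y hy => by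
      have hy' := congrArg (𝓔.prolongation IP pr y).subtype hy
      rw [map_sum] at hy'
      exact ⟨(congrArg Prod.fst hy').trans Prod.fst_sum,
        (congrArg Prod.snd hy').trans Prod.snd_sum⟩
    have fst_eq := Z.bracketFst_eq_sum Z' hgx (components.mono fun _ hy => hy.1)
      components.self_of_nhds.2
    have vec_eq := mlieBracket_eq_sum_of_eventually Z.contMDiff_vec Z'.contMDiff_vec
      (fun b => (W b).contMDiff_vec) hgx (components.mono fun _ hy => hy.2)
    refine Subtype.ext ?_
    rw [Submodule.coe_add, Submodule.coe_sum, Submodule.coe_sum]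
    refine Prod.ext (fst_eq.trans ?_) (vec_eq.trans ?_)
    · rw [Prod.fst_add, Prod.fst_sum, Prod.fst_sum]
      rfl
    · rw [Prod.snd_add, Prod.snd_sum, Prod.snd_sum]
      rfl

end LieAlgebroid

end Prolongation

section Retraction

variable {EQ : Type*} [NormedAddCommGroup EQ] [NormedSpace ℝ EQ]
  {HQ : Type*} [TopologicalSpace HQ] {I : ModelWithCorners ℝ EQ HQ}
  {Q : Type*} [TopologicalSpace Q] [ChartedSpace HQ Q]
  {F : Type*} [NormedAddCommGroup F] [NormedSpace ℝ F]
  {E : Q → Type*} [∀ q, AddCommGroup (E q)] [∀ q, Module ℝ (E q)]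
  [TopologicalSpace (TotalSpace F E)] [∀ q, TopologicalSpace (E q)]
  [FiberBundle F E] [VectorBundle ℝ F E]
  {EP : Type*} [NormedAddCommGroup EP] [NormedSpace ℝ EP]
  {HP : Type*} [TopologicalSpace HP] {IP : ModelWithCorners ℝ EP HP}
  {P : Type*} [TopologicalSpace P] [ChartedSpace HP P]
  {pr : P → Q} {a : ∀ p, E (pr p)}

theorem contMDiff_smul_section_along {h : P → ℝ} (hh : ContMDiff IP 𝓘(ℝ, ℝ) ∞ h)
    (ha : ContMDiff IP (I.prod 𝓘(ℝ, F)) ∞ fun p => (⟨pr p, a p⟩ : TotalSpace F E)) :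
    ContMDiff IP (I.prod 𝓘(ℝ, F)) ∞ fun p => (⟨pr p, h p • a p⟩ : TotalSpace F E) := by
  intro p
  obtain ⟨pr_smooth, a_smooth⟩ := contMDiffAt_totalSpace.1 (ha p)
  refine contMDiffAt_totalSpace.2
    ⟨pr_smooth, ((hh p).smul a_smooth).congr_of_eventuallyEq ?_⟩
  filter_upwards [pr_smooth.continuousAt.eventually
    ((trivializationAt F E (pr p)).open_baseSet.mem_nhds
      (mem_baseSet_trivializationAt F E (pr p)))] with y hy
  exact ((trivializationAt F E (pr p)).linear ℝ hy).map_smul (h y) (a y)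

namespace LieAlgebroid

variable [FiniteDimensional ℝ EP] [IsManifold IP ∞ P] [T2Space P] [IsManifold I ∞ Q]
  {𝓔 : LieAlgebroid I F E} {X : ∀ p : P, TangentSpace IP p} {p₀ : P}

theorem exists_prolongationSection_eventually_eq
    (ha : ContMDiff IP (I.prod 𝓘(ℝ, F)) ∞ fun p => (⟨pr p, a p⟩ : TotalSpace F E))
    (hX : ContMDiff IP IP.tangent ∞ fun p => (⟨p, X p⟩ : TangentBundle IP P))
    (haX : ∀ᶠ p in 𝓝 p₀, (a p, X p) ∈ 𝓔.prolongation IP pr p) :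
    ∃ Z : 𝓔.ProlongationSection IP pr, ∀ᶠ p in 𝓝 p₀, (Z.fst p, Z.vec p) = (a p, X p) := by
  obtain ⟨ψ, -, hψ⟩ := (SmoothBumpFunction.nhds_basis_tsupport (I := IP) p₀).mem_iff.1 haX
  have smul_mem : ∀ p, (ψ p • a p, ψ p • X p) ∈ 𝓔.prolongation IP pr p := fun p => by
    by_cases hp : p ∈ tsupport ψ
    · exact (𝓔.prolongation IP pr p).smul_mem (ψ p) (hψ hp)
    · simp only [image_eq_zero_of_notMem_tsupport hp, zero_smul]
      exact (𝓔.prolongation IP pr p).zero_mem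
  refine ⟨⟨fun p => ψ p • a p, fun p => ψ p • X p, contMDiff_smul_section_along ψ.contMDiff ha,
    ψ.contMDiff.smul_section hX, smul_mem⟩, ψ.eventuallyEq_one.mono fun p hp => ?_⟩
  simp only [hp, Pi.one_apply, one_smul]

variable [FiniteDimensional ℝ EQ] [T2Space Q]

/-- With a local right inverse `S` of `Tpr`, the retraction is
`(a, v) ↦ (a, v + S (ρ(a) - Tpr(v)))`. -/
theorem exists_local_retraction (𝓔 : LieAlgebroid I F E) (hpr : ContMDiff IP I ∞ pr)
    (hp₀ : Function.Surjective (mfderiv IP I pr p₀)) :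
    ∃ R : ∀ p, (E (pr p) × TangentSpace IP p) →ₗ[ℝ] E (pr p) × TangentSpace IP p,
      (∀ p, ∀ z ∈ 𝓔.prolongation IP pr p, R p z = z) ∧
      ∀ {a : ∀ p, E (pr p)} {X : ∀ p : P, TangentSpace IP p},
        ContMDiff IP (I.prod 𝓘(ℝ, F)) ∞ (fun p => (⟨pr p, a p⟩ : TotalSpace F E)) →
        ContMDiff IP IP.tangent ∞ (fun p => (⟨p, X p⟩ : TangentBundle IP P)) →
        ∃ Z : 𝓔.ProlongationSection IP pr,
          ∀ᶠ p in 𝓝 p₀, (Z.fst p, Z.vec p) = R p (a p, X p) := by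
  obtain ⟨S, hS, S_smooth⟩ := exists_local_rightInverse_mfderiv hpr hp₀
  let C : ∀ p, (E (pr p) × TangentSpace IP p) →ₗ[ℝ] TangentSpace IP p := fun p =>
    LinearMap.snd ℝ _ _ + (S p ∘ₗ 𝓔.anchor (pr p) ∘ₗ LinearMap.fst ℝ _ _ -
      S p ∘ₗ (mfderiv IP I pr p).toLinearMap ∘ₗ LinearMap.snd ℝ _ _)
  refine ⟨fun p => (LinearMap.fst ℝ _ _).prod (C p), fun p z hz => ?_, fun {a X} ha hX => ?_⟩
  · have hz' : 𝓔.anchor (pr p) z.1 = mfderiv IP I pr p z.2 := hz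
    refine Prod.ext rfl ?_
    change z.2 + (S p (𝓔.anchor (pr p) z.1) - S p (mfderiv IP I pr p z.2)) = z.2
    rw [hz', sub_self, add_zero]
  · refine exists_prolongationSection_eventually_eq ha (X := fun p => C p (a p, X p)) ?_ ?_
    · exact hX.add_section ((S_smooth (𝓔.contMDiff_anchor.comp ha)).sub_section
        (S_smooth ((hpr.contMDiff_tangentMap (m := ∞) le_rfl).comp hX)))
    · filter_upwards [hS] with p hp
      change 𝓔.anchor (pr p) (a p) = mfderiv IP I pr p (X p +
        (S p (𝓔.anchor (pr p) (a p)) - S p (mfderiv IP I pr p (X p))))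
      rw [map_add, map_sub, hp, hp, add_sub_cancel]

variable [FiniteDimensional ℝ F] [ContMDiffVectorBundle ∞ F E I] [I.Boundaryless] [IP.Boundaryless]

theorem exists_isLocalFrame_prolongationData (𝓔 : LieAlgebroid I F E) (hpr : ContMDiff IP I ∞ pr)
    (hp₀ : Function.Surjective (mfderiv IP I pr p₀)) :
    ∃ (ι : Type) (_ : Fintype ι) (W : ι → 𝓔.ProlongationSection IP pr)
      (θ : ι → ∀ p, 𝓔.prolongation IP pr p → ℝ),
      (𝓔.prolongationData IP hpr).IsLocalFrame W θ p₀ := by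
  obtain ⟨R, hR, exists_section⟩ := 𝓔.exists_local_retraction hpr hp₀
  let e := frame I F E (pr p₀)
  let k := frame IP EP (TangentSpace IP : P → Type _) p₀
  let θ := coframeAt I F E (pr p₀)
  let κ := coframeAt IP EP (TangentSpace IP : P → Type _) p₀
  choose U hU using fun i =>
    exists_section ((e i).contMDiff.comp hpr) (contMDiff_zeroSection ℝ (TangentSpace IP))
  choose V hV using fun j => exists_section ((contMDiff_zeroSection ℝ E).comp hpr) (k j).contMDiff
  refine ⟨Fin (finrank ℝ F) ⊕ Fin (finrank ℝ EP), inferInstance, Sum.elim U V,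
    Sum.elim (fun i p z => θ i (pr p) z.1.1) (fun j p z => κ j p z.1.2), ?_, ?_⟩
  · rintro Z (i | j)
    · exact contMDiff_coframeAt (ProlongationSection.contMDiff_fst Z) (pr p₀) i
    · exact contMDiff_coframeAt (f := id) (ProlongationSection.contMDiff_vec Z) p₀ j
  · filter_upwards [eventually_all.2 hU, eventually_all.2 hV,
      eventually_bump_comp_eq_one (I := I) (F := F) (E := E) hpr.continuous.continuousAt,
      (bump IP EP (TangentSpace IP : P → Type _) p₀).eventuallyEq_one]
      with p hUp hVp hp hp' z
    refine Subtype.ext ?_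
    calc ((∑ b, _ : 𝓔.prolongation IP pr p) : E (pr p) × TangentSpace IP p)
        = ∑ i, θ i (pr p) z.1.1 • (((U i).fst p, (U i).vec p) : E (pr p) × TangentSpace IP p) +
          ∑ j, κ j p z.1.2 • (((V j).fst p, (V j).vec p) : E (pr p) × TangentSpace IP p) := by
          rw [Submodule.coe_sum, Fintype.sum_sum_type]
          rfl
      _ = R p (∑ i, θ i (pr p) z.1.1 • (e i (pr p), 0) + ∑ j, κ j p z.1.2 • (0, k j p)) := by
          simp only [hUp, hVp, map_add, map_sum, map_smul]
      _ = R p (z.1.1, z.1.2) := by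
          simp only [Prod.smul_mk, smul_zero, ← prod_mk_sum, Finset.sum_const_zero,
            Prod.mk_add_mk, add_zero, zero_add]
          rw [sum_coframeAt_smul_frame hp, sum_coframeAt_smul_frame hp']
      _ = z := hR p z z.2

end LieAlgebroid

end Retraction

section RelatedSections

variable {EQ : Type*} [NormedAddCommGroup EQ] [NormedSpace ℝ EQ]
  {HQ : Type*} [TopologicalSpace HQ] {I : ModelWithCorners ℝ EQ HQ}
  {Q : Type*} [TopologicalSpace Q] [ChartedSpace HQ Q]
  {EP : Type*} [NormedAddCommGroup EP] [NormedSpace ℝ EP]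
  {HP : Type*} [TopologicalSpace HP] {IP : ModelWithCorners ℝ EP HP}
  {P : Type*} [TopologicalSpace P] [ChartedSpace HP P]
  {pr : P → Q} {γ : Q → P} {x : Q}

theorem mfderiv_mfderiv_of_leftInverse (hprγ : Function.LeftInverse pr γ)
    (hpr : MDifferentiableAt IP I pr (γ x)) (hγ : MDifferentiableAt I IP γ x)
    (v : TangentSpace I x) : mfderiv IP I pr (γ x) (mfderiv I IP γ x v) = v := by
  rw [← mfderiv_comp_apply x hpr hγ, hprγ.comp_eq_id, mfderiv_id]
  rfl

theorem surjective_mfderiv_of_leftInverse (hprγ : Function.LeftInverse pr γ)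
    (hpr : MDifferentiableAt IP I pr (γ x)) (hγ : MDifferentiableAt I IP γ x) :
    Function.Surjective (mfderiv IP I pr (γ x)) := fun v =>
  ⟨mfderiv I IP γ x v, mfderiv_mfderiv_of_leftInverse hprγ hpr hγ v⟩

variable [IsManifold I ∞ Q]
  {F : Type*} [NormedAddCommGroup F] [NormedSpace ℝ F]
  {E : Q → Type*} [∀ q, AddCommGroup (E q)] [∀ q, Module ℝ (E q)]
  [TopologicalSpace (TotalSpace F E)] [∀ q, TopologicalSpace (E q)]
  [FiberBundle F E] [VectorBundle ℝ F E]
  [FiniteDimensional ℝ EP] [IsManifold IP ∞ P] [T2Space P]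

theorem exists_vectorField_related (hprγ : Function.LeftInverse pr γ) (hpr : ContMDiff IP I ∞ pr)
    (hγ : ContMDiff I IP ∞ γ) {V : ∀ q : Q, TangentSpace I q}
    (hV : ContMDiff I I.tangent ∞ fun q => (⟨q, V q⟩ : TangentBundle I Q)) (x : Q) :
    ∃ X : ∀ p : P, TangentSpace IP p,
      ContMDiff IP IP.tangent ∞ (fun p => (⟨p, X p⟩ : TangentBundle IP P)) ∧
      ∀ᶠ q in 𝓝 x, X (γ q) = mfderiv I IP γ q (V q) := by
  have hγV : ContMDiff I IP.tangent ∞ fun q =>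
      (⟨γ q, mfderiv I IP γ q (V q)⟩ : TangentBundle IP P) :=
    (hγ.contMDiff_tangentMap (m := ∞) le_rfl).comp hV
  let c : Fin (finrank ℝ EP) → Q → ℝ := fun j q =>
    coframeAt IP EP (TangentSpace IP : P → Type _) (γ x) j (γ q) (mfderiv I IP γ q (V q))
  have hc : ∀ j, ContMDiff I 𝓘(ℝ, ℝ) ∞ (c j) := contMDiff_coframeAt hγV (γ x)
  let X := ∑ j, smulSection ⟨fun p => c j (pr p), (hc j).comp hpr⟩
    (frame IP EP (TangentSpace IP : P → Type _) (γ x) j)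
  refine ⟨X, X.contMDiff, ?_⟩
  filter_upwards [eventually_bump_comp_eq_one (I := IP) (F := EP)
    (E := (TangentSpace IP : P → Type _)) hγ.continuous.continuousAt] with q hq
  calc X (γ q) = ∑ j, c j (pr (γ q)) • frame IP EP (TangentSpace IP : P → Type _) (γ x) j (γ q) :=
        LieAlgebroid.sum_section_apply _ _ _
    _ = mfderiv I IP γ q (V q) := by
        rw [hprγ q]
        exact sum_coframeAt_smul_frame hq _

namespace LieAlgebroid

variable [FiniteDimensional ℝ EQ] [T2Space Q] {𝓔 : LieAlgebroid I F E}

theorem exists_prolongationSection_related (hprγ : Function.LeftInverse pr γ)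
    (hpr : ContMDiff IP I ∞ pr) (hγ : ContMDiff I IP ∞ γ) (σ : Cₛ^∞⟮I; F, E⟯) (x : Q) :
    ∃ Z : 𝓔.ProlongationSection IP pr, ∀ᶠ q in 𝓝 x,
      Z.fst (γ q) = σ (pr (γ q)) ∧ Z.vec (γ q) = mfderiv I IP γ q (𝓔.anchor q (σ q)) := by
  obtain ⟨X, hX, hXγ⟩ := exists_vectorField_related hprγ hpr hγ (𝓔.contMDiff_anchor_section σ) x
  obtain ⟨R, hR, exists_section⟩ := 𝓔.exists_local_retraction hpr
    (surjective_mfderiv_of_leftInverse hprγ (hpr.mdifferentiableAt (by simp))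
      (hγ.mdifferentiableAt (by simp) (x := x)))
  obtain ⟨Z, hZ⟩ := exists_section (σ.contMDiff.comp hpr) hX
  refine ⟨Z, ?_⟩
  filter_upwards [hγ.continuous.continuousAt.eventually hZ, hXγ] with q hZq hXq
  have mem_prolongation : (σ (pr (γ q)), X (γ q)) ∈ 𝓔.prolongation IP pr (γ q) := by
    change 𝓔.anchor (pr (γ q)) (σ (pr (γ q))) = mfderiv IP I pr (γ q) (X (γ q))
    rw [hXq]
    refine Eq.trans ?_ (mfderiv_mfderiv_of_leftInverse hprγ (hpr.mdifferentiableAt (by simp))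
      (hγ.mdifferentiableAt (by simp)) _).symm
    rw [hprγ q]
  rw [hR _ _ mem_prolongation] at hZq
  exact ⟨congrArg Prod.fst hZq, (congrArg Prod.snd hZq).trans hXq⟩

variable [I.Boundaryless] [IP.Boundaryless] {Z Y : 𝓔.ProlongationSection IP pr}
  {σ τ : Cₛ^∞⟮I; F, E⟯}

theorem mlieBracket_vec_of_related (hγ : ContMDiff I IP ∞ γ)
    (hZ : ∀ᶠ q in 𝓝 x, Z.vec (γ q) = mfderiv I IP γ q (𝓔.anchor q (σ q)))
    (hY : ∀ᶠ q in 𝓝 x, Y.vec (γ q) = mfderiv I IP γ q (𝓔.anchor q (τ q))) :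
    mlieBracket IP Z.vec Y.vec (γ x) =
      mfderiv I IP γ x (𝓔.anchor x (𝓔.bracket σ τ x)) := by
  rw [𝓔.anchor_bracket]
  exact mfderiv_mlieBracket_of_related hγ (𝓔.contMDiff_anchor_section σ)
    (𝓔.contMDiff_anchor_section τ) Z.contMDiff_vec Y.contMDiff_vec hZ hY

end LieAlgebroid

end RelatedSections

section RelatedBrackets

variable {EQ : Type*} [NormedAddCommGroup EQ] [NormedSpace ℝ EQ] [FiniteDimensional ℝ EQ]
  {HQ : Type*} [TopologicalSpace HQ] {I : ModelWithCorners ℝ EQ HQ}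
  {Q : Type*} [TopologicalSpace Q] [ChartedSpace HQ Q] [IsManifold I ∞ Q] [T2Space Q]
  {F : Type*} [NormedAddCommGroup F] [NormedSpace ℝ F] [FiniteDimensional ℝ F]
  {E : Q → Type*} [∀ q, AddCommGroup (E q)] [∀ q, Module ℝ (E q)]
  [TopologicalSpace (TotalSpace F E)] [∀ q, TopologicalSpace (E q)]
  [FiberBundle F E] [VectorBundle ℝ F E] [ContMDiffVectorBundle ∞ F E I]
  {EP : Type*} [NormedAddCommGroup EP] [NormedSpace ℝ EP]
  {HP : Type*} [TopologicalSpace HP] {IP : ModelWithCorners ℝ EP HP}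
  {P : Type*} [TopologicalSpace P] [ChartedSpace HP P] [IsManifold IP ∞ P]
  {pr : P → Q} {γ : Q → P} {x : Q}

namespace LieAlgebroid

variable {𝓔 : LieAlgebroid I F E} {Z Y : 𝓔.ProlongationSection IP pr} {σ τ : Cₛ^∞⟮I; F, E⟯}

theorem mvfderiv_coeff_of_related (hprγ : Function.LeftInverse pr γ) (hγ : ContMDiff I IP ∞ γ)
    (hY : ∀ᶠ q in 𝓝 x, Y.fst (γ q) = τ (pr (γ q)))
    (hZ : Z.vec (γ x) = mfderiv I IP γ x (𝓔.anchor x (σ x))) (q₀ : Q) (j : Fin (finrank ℝ F)) :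
    mvfderiv IP (Y.coeff q₀ j) (γ x) (Z.vec (γ x)) =
      mvfderiv I (fun q => coframeAt I F E q₀ j q (τ q)) (pr (γ x))
        (𝓔.anchor (pr (γ x)) (σ (pr (γ x)))) := by
  have coeff_comp : Y.coeff q₀ j ∘ γ =ᶠ[𝓝 x] fun q => coframeAt I F E q₀ j q (τ q) := by
    filter_upwards [hY] with q hq
    rw [Function.comp_apply, ProlongationSection.coeff, coframe_eq_coframeAt, hq]
    exact congrArg (fun q => coframeAt I F E q₀ j q (τ q)) (hprγ q)
  rw [hZ, ← mvfderiv_comp_apply x ((Y.contMDiff_coeff q₀ j).mdifferentiableAt (by simp))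
    (hγ.mdifferentiableAt (by simp)), mvfderiv_congr coeff_comp]
  exact congrArg (fun q => mvfderiv I (fun q => coframeAt I F E q₀ j q (τ q)) q
    (𝓔.anchor q (σ q))) (hprγ x).symm

theorem bracket_apply_eq_sum (σ τ : Cₛ^∞⟮I; F, E⟯) (q : Q) :
    𝓔.bracket σ τ q =
      (∑ i, ∑ j, (coframeAt I F E q i q (σ q) * coframeAt I F E q j q (τ q)) •
        𝓔.bracket (frame I F E q i) (frame I F E q j) q) +
      (∑ j, mvfderiv I (fun y => coframeAt I F E q j y (τ y)) q (𝓔.anchor q (σ q)) •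
          frame I F E q j q -
        ∑ i, mvfderiv I (fun y => coframeAt I F E q i y (σ y)) q (𝓔.anchor q (τ q)) •
          frame I F E q i q) :=
  ((𝓔.isLocalFrame_data q).bracket_eq 𝓔.isLeibniz_data σ τ).trans
    (congrArg₂ (fun a b : E q => _ + (a - b)) (BracketData.frameDeriv_apply _ _)
      (BracketData.frameDeriv_apply _ _))

theorem bracketFst_of_related (hprγ : Function.LeftInverse pr γ) (hγ : ContMDiff I IP ∞ γ)
    (hZ : ∀ᶠ q in 𝓝 x, Z.fst (γ q) = σ (pr (γ q)) ∧
      Z.vec (γ q) = mfderiv I IP γ q (𝓔.anchor q (σ q)))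
    (hY : ∀ᶠ q in 𝓝 x, Y.fst (γ q) = τ (pr (γ q)) ∧
      Y.vec (γ q) = mfderiv I IP γ q (𝓔.anchor q (τ q))) :
    ProlongationSection.bracketFst Z Y (pr (γ x)) (γ x) = 𝓔.bracket σ τ (pr (γ x)) := by
  obtain ⟨Z_fst, Z_vec⟩ := hZ.self_of_nhds
  obtain ⟨Y_fst, Y_vec⟩ := hY.self_of_nhds
  simp only [bracket_apply_eq_sum σ τ, ProlongationSection.bracketFst, add_sub_assoc,
    mvfderiv_coeff_of_related hprγ hγ (hY.mono fun _ => And.left) Z_vec,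
    mvfderiv_coeff_of_related hprγ hγ (hZ.mono fun _ => And.left) Y_vec,
    ProlongationSection.coeff, coframe_eq_coframeAt, Z_fst, Y_fst]

end LieAlgebroid

end RelatedBrackets

theorem t2Space_totalSpace {B : Type*} (F : Type*) (E : B → Type*)
    [TopologicalSpace B] [TopologicalSpace F] [TopologicalSpace (TotalSpace F E)]
    [∀ b, TopologicalSpace (E b)] [FiberBundle F E] [T2Space B] [T2Space F] :
    T2Space (TotalSpace F E) := by
  refine ⟨fun x y hxy => ?_⟩
  by_cases h : x.proj = y.proj
  · let e := trivializationAt F E x.proj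
    have hx : x ∈ e.source := FiberBundle.mem_trivializationAt_proj_source
    have hy : y ∈ e.source := by
      rw [e.mem_source, ← h]
      exact FiberBundle.mem_baseSet_trivializationAt F E x.proj
    obtain ⟨u, v, hu, hv, hxu, hyv, huv⟩ := t2_separation (e.injOn.ne hx hy hxy)
    refine ⟨e.source ∩ e ⁻¹' u, e.source ∩ e ⁻¹' v,
      e.continuousOn.isOpen_inter_preimage e.open_source hu,
      e.continuousOn.isOpen_inter_preimage e.open_source hv, ⟨hx, hxu⟩, ⟨hy, hyv⟩, ?_⟩
    exact (huv.preimage e).mono inter_subset_right inter_subset_right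
  · obtain ⟨u, v, hu, hv, hxu, hyv, huv⟩ := t2_separation h
    exact ⟨_, _, hu.preimage (FiberBundle.continuous_proj F E),
      hv.preimage (FiberBundle.continuous_proj F E), hxu, hyv, huv.preimage _⟩

section ContactLift

variable {EQ : Type*} [NormedAddCommGroup EQ] [NormedSpace ℝ EQ]
  {HQ : Type*} [TopologicalSpace HQ] {I : ModelWithCorners ℝ EQ HQ}
  {Q : Type*} [TopologicalSpace Q] [ChartedSpace HQ Q] [IsManifold I ∞ Q]
  {F : Type*} [NormedAddCommGroup F] [NormedSpace ℝ F]
  {E : Q → Type*} [∀ q, AddCommGroup (E q)] [∀ q, Module ℝ (E q)]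
  [TopologicalSpace (TotalSpace F E)] [∀ q, TopologicalSpace (E q)]
  [∀ q, IsTopologicalAddGroup (E q)] [∀ q, ContinuousSMul ℝ (E q)]
  [FiberBundle F E] [VectorBundle ℝ F E] [ContMDiffVectorBundle ∞ F E I]

namespace LieAlgebroid

variable (𝓔 : LieAlgebroid I F E) (γ₀ : Cₛ^∞⟮I; F →L[ℝ] ℝ, DualFiber E⟯) (γs : C^∞⟮I, Q; ℝ⟯)

theorem pullbackForm_contactForm (q : Q) (a : E q) :
    pullbackForm (dualSection γ₀ γs) (𝓔.liftMap γ₀ γs) 𝓔.contactForm q (fun _ => a) =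
      𝓔.differential γs q a - γ₀ q a := by
  have mvfderiv_snd : mvfderiv (dualModel I F) (Prod.snd : DualR F E → ℝ) (dualSection γ₀ γs q)
      (mfderiv I (dualModel I F) (dualSection γ₀ γs) q (𝓔.anchor q a)) =
      mvfderiv I γs q (𝓔.anchor q a) :=
    (mvfderiv_comp_apply q ((contMDiff_snd (n := ∞)).mdifferentiableAt (by simp))
      ((contMDiff_dualSection γ₀ γs).mdifferentiableAt (by simp)) _).symm
  exact congrArg (· - γ₀ q a) mvfderiv_snd

variable [FiniteDimensional ℝ EQ] [I.Boundaryless] [T2Space Q] [FiniteDimensional ℝ F]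
  {𝓔 γ₀ γs}

theorem isRelatedAt_liftMap_iff {σ : Cₛ^∞⟮I; F, E⟯} {x : Q}
    {Z : 𝓔.ProlongationSection (dualModel I F) dualProj} :
    IsRelatedAt 𝓔.data 𝓔.contactProlongationData (𝓔.liftMap γ₀ γs) σ Z x ↔
      ∀ᶠ q in 𝓝 x, Z.fst (dualSection γ₀ γs q) = σ q ∧ Z.vec (dualSection γ₀ γs q) =
        mfderiv I (dualModel I F) (dualSection γ₀ γs) q (𝓔.anchor q (σ q)) :=
  eventually_congr <| .of_forall fun _ => Subtype.ext_iff.trans Prod.ext_iff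

variable (𝓔 γ₀ γs)

theorem isLieAlgebroidMorphism_liftMap :
    IsLieAlgebroidMorphism 𝓔.data 𝓔.contactProlongationData
      (dualSection γ₀ γs) (𝓔.liftMap γ₀ γs) := by
  have : T2Space (TotalSpace (F →L[ℝ] ℝ) (DualFiber E)) := t2Space_totalSpace _ _
  have hpr := contMDiff_dualProj I F E
  have hγ := contMDiff_dualSection γ₀ γs
  have hprγ : Function.LeftInverse dualProj (dualSection γ₀ γs) := fun _ => rfl
  refine isLieAlgebroidMorphism_of_isRelatedAt hγ (isLeibniz_prolongationData hpr)
    (fun x => 𝓔.exists_isLocalFrame_prolongationData hpr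
      (surjective_mfderiv_of_leftInverse hprγ (hpr.mdifferentiableAt (by simp))
        (hγ.mdifferentiableAt (by simp) (x := x))))
    (fun _ _ => rfl) (fun x σ => ?_) fun {x σ τ Z Y} hZ hY => ?_
  · obtain ⟨Z, hZ⟩ := 𝓔.exists_prolongationSection_related hprγ hpr hγ σ x
    exact ⟨Z, isRelatedAt_liftMap_iff.2 hZ⟩
  · have hZ' := isRelatedAt_liftMap_iff.1 hZ
    have hY' := isRelatedAt_liftMap_iff.1 hY
    exact Subtype.ext (Prod.ext (bracketFst_of_related hprγ hγ hZ' hY')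
      (mlieBracket_vec_of_related hγ (hZ'.mono fun _ => And.right)
        (hY'.mono fun _ => And.right)))

end LieAlgebroid

end ContactLift

end

theorem mainTheorem5
    {EQ : Type*} [NormedAddCommGroup EQ] [NormedSpace ℝ EQ] [FiniteDimensional ℝ EQ]
    {HQ : Type*} [TopologicalSpace HQ] {I : ModelWithCorners ℝ EQ HQ} [I.Boundaryless]
    {Q : Type*} [TopologicalSpace Q] [ChartedSpace HQ Q] [IsManifold I ∞ Q] [T2Space Q]
    {F : Type*} [NormedAddCommGroup F] [NormedSpace ℝ F] [FiniteDimensional ℝ F]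
    {E : Q → Type*} [∀ q, AddCommGroup (E q)] [∀ q, Module ℝ (E q)]
    [TopologicalSpace (TotalSpace F E)] [∀ q, TopologicalSpace (E q)]
    [∀ q, IsTopologicalAddGroup (E q)] [∀ q, ContinuousSMul ℝ (E q)]
    [FiberBundle F E] [VectorBundle ℝ F E] [ContMDiffVectorBundle ∞ F E I]
    (𝓔 : LieAlgebroid I F E)
    (γ₀ : Cₛ^∞⟮I; F →L[ℝ] ℝ, DualFiber E⟯) (γs : C^∞⟮I, Q; ℝ⟯) :
    IsLieAlgebroidMorphism 𝓔.data 𝓔.contactProlongationData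
        (dualSection γ₀ γs) (𝓔.liftMap γ₀ γs) ∧
      ∀ (q : Q) (a : E q),
        pullbackForm (dualSection γ₀ γs) (𝓔.liftMap γ₀ γs) 𝓔.contactForm q (fun _ => a) =
          𝓔.differential γs q a - γ₀ q a :=
  ⟨𝓔.isLieAlgebroidMorphism_liftMap γ₀ γs, 𝓔.pullbackForm_contactForm γ₀ γs⟩
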